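/- **Theorem 1.1 (Homogenization of the delay equation).** Let $0<\xi\le\tau$, $0<T\le+\infty$, $C_F\ge 0$ and $L\ge 0$. Assume that - $F:\mathbb R\to\mathbb R$ is nondecreasing, bounded and $C_F$-Lipschitz continuous; - $\tau_0:\mathbb R\to\mathbb R$ satisfies $\overline{\tau_0(\mathbb R)}=[\xi,\tau]$ (no regularity of $\tau_0$ is assumed); - $u_0$ is $L$-Lipschitz continuous on $\mathbb R\times[-2\tau,0]$; - $\tau<\dfrac1{e\,C_F}$ (that is, $e\,C_F\,\tau<1$; no condition if $C_F=0$). For every $\varepsilon\in(0,1]$ the problem $$\begin{cases}\partial_t u^\varepsilon(x,t)=F\left(\dfrac{u^\varepsilon(x+\varepsilon,\,t-\varepsilon\tau_0(x))-u^\varepsilon(x,\,t-\varepsilon\tau_0(x))}{\varepsilon}\right), & (x,t)\in\mathbb R\times(0,T),\\[2mm] u^\varepsilon(x,s)=u_0(x,s), & (x,s)\in\mathbb R\times[-2\varepsilon\tau,0],\end{cases}$$ has a unique classical solution $u^\varepsilon$ on $\mathbb R\times[-2\varepsilon\tau,T)$, where a classical solution is a function such that for every $x$ the map $t\mapsto u^\varepsilon(x,t)$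 is continuous on $[0,T)$ and differentiable on $(0,T)$, and the two lines above hold at every point. The problem $$\partial_t u=F(\partial_x u)\ \text{ in }\mathbb R\times(0,T),\qquad u(x,0)=u_0(x,0)\ \text{ for }x\in\mathbb R,$$ has a unique viscosity solution $u^0$ in the class of continuous functions on $\mathbb R\times[0,T)$. As $\varepsilon\to0^+$, $u^\varepsilon$ converges to $u^0$ locally uniformly on $\mathbb R\times[0,T)$. Here a continuous function $u$ is a viscosity solution of the last equation if, for every $\varphi\in C^1(\mathbb R^2)$ and $(x,t)\in\mathbb R\times(0,T)$, one has $\partial_t\varphi\le F(\partial_x\varphi)$ at $(x,t)$ whenever $u-\varphi$ has a local maximum there, and $\partial_t\varphi\ge F(\partial_x\varphi)$ at $(x,t)$ whenever $u-\varphi$ has a local minimum there. -/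

import Mathlib

open Set Filter Topology
open scoped NNReal

/-- The half-open time interval `[a, T)`, where the horizon `T` may be `+∞`. -/
def timeIco (a : ℝ) (T : EReal) : Set ℝ := {t : ℝ | a ≤ t ∧ (t : EReal) < T}

/-- The open time interval `(a, T)`, where the horizon `T` may be `+∞`. -/
def timeIoo (a : ℝ) (T : EReal) : Set ℝ := {t : ℝ | a < t ∧ (t : EReal) < T}

/-- `u` is a classical solution on `ℝ × [-2ετ, T)` of the rescaled delayed equation
`∂ₜ u(x,t) = F ((u(x+ε, t-ετ₀(x)) - u(x, t-ετ₀(x))) / ε)` for `(x,t) ∈ ℝ × (0,T)`, with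
`u = u₀` on `ℝ × [-2ετ, 0]`. No regularity in `x` is required (the delay `τ₀` has none); the
continuity in time up to `t = 0` connects the equation with the initial data. -/
structure IsDelaySolution (F : ℝ → ℝ) (τ₀ : ℝ → ℝ) (τ : ℝ) (u₀ : ℝ → ℝ → ℝ) (T : EReal)
    (ε : ℝ) (u : ℝ → ℝ → ℝ) : Prop where
  initial : ∀ x : ℝ, ∀ s ∈ Icc (-(2 * ε * τ)) 0, u x s = u₀ x s
  continuousOn : ∀ x : ℝ, ContinuousOn (u x) (timeIco 0 T)
  equation : ∀ x : ℝ, ∀ t ∈ timeIoo 0 T,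
    HasDerivAt (u x) (F ((u (x + ε) (t - ε * τ₀ x) - u x (t - ε * τ₀ x)) / ε)) t

/-- Viscosity subsolution of `∂ₜ u = F (∂ₓ u)` in `ℝ × (0,T)`: whenever `u - φ` has a local
maximum at `(x,t)` for a `C¹` test function `φ`, one has `∂ₜ φ ≤ F (∂ₓ φ)` at `(x,t)`. -/
def IsViscositySubsolution (F : ℝ → ℝ) (T : EReal) (u : ℝ → ℝ → ℝ) : Prop :=
  ∀ φ : ℝ × ℝ → ℝ, ContDiff ℝ 1 φ → ∀ x : ℝ, ∀ t ∈ timeIoo 0 T,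
    IsLocalMax (fun p : ℝ × ℝ => u p.1 p.2 - φ p) (x, t) →
      fderiv ℝ φ (x, t) (0, 1) ≤ F (fderiv ℝ φ (x, t) (1, 0))

/-- Viscosity supersolution of `∂ₜ u = F (∂ₓ u)` in `ℝ × (0,T)`: whenever `u - φ` has a local
minimum at `(x,t)` for a `C¹` test function `φ`, one has `∂ₜ φ ≥ F (∂ₓ φ)` at `(x,t)`. -/
def IsViscositySupersolution (F : ℝ → ℝ) (T : EReal) (u : ℝ → ℝ → ℝ) : Prop :=
  ∀ φ : ℝ × ℝ → ℝ, ContDiff ℝ 1 φ → ∀ x : ℝ, ∀ t ∈ timeIoo 0 T,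
    IsLocalMin (fun p : ℝ × ℝ => u p.1 p.2 - φ p) (x, t) →
      F (fderiv ℝ φ (x, t) (1, 0)) ≤ fderiv ℝ φ (x, t) (0, 1)

/-- `u` is a (continuous) viscosity solution on `ℝ × [0,T)` of the Cauchy problem
`∂ₜ u = F (∂ₓ u)` in `ℝ × (0,T)`, `u(·,0) = g`. -/
structure IsViscositySolution (F : ℝ → ℝ) (g : ℝ → ℝ) (T : EReal) (u : ℝ → ℝ → ℝ) : Prop where
  continuousOn : ContinuousOn (fun p : ℝ × ℝ => u p.1 p.2) (univ ×ˢ timeIco 0 T)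
  initial : ∀ x : ℝ, u x 0 = g x
  subsolution : IsViscositySubsolution F T u
  supersolution : IsViscositySupersolution F T u

/-! Every delay is at least `ε * ξ`, so the right-hand side at time `t` is known once `u` is known
up to `t - ε * ξ`: the method of steps gives existence and uniqueness. Since `|F| ≤ M`, the
solutions stay within `M * t` of the initial datum uniformly in `ε`, so their half-relaxed limits
(`relaxedLimsup`) are finite and start from that datum.

The core is that the upper relaxed limit is a subsolution. If not, a smooth strict supersolution `ψ`
touches it from above. Let `W = ψ - u - c`. As long as the past values of `W` at `x` and at its
right neighbour `x + ε` are nonnegative, monotonicity and the Lipschitz bound of `F` give `W'(t) ≥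
-(CF / ε) * W(t - d)` with `d ≤ ε * τ`. A delayed inequality of this kind can lose positivity by
oscillating, but not if `W` decays at most at a rate `ν` with `(CF / ε) * exp (ν * d) ≤ ν`. At the
longest delay the choice `ν = 1 / (ε * τ)` is admissible exactly when `exp 1 * CF * τ ≤ 1`
(`monotoneOn_exp_mul_extend`, `IsDelaySolution.add_le_of_supersolution`).

The symmetry `F ↦ -F(-·)`, `u ↦ -u` treats the lower limit. Comparison by doubling of variables
(`IsViscositySubsolution.add_nonpos`) then forces the two limits to coincide, which yields
existence, continuity and locally uniform convergence together. -/

/-- The integral operator whose fixed points solve the delayed equation. The initial datum is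
frozen outside `[-2ετ, 0]`. -/
noncomputable def delayStep (F τ₀ : ℝ → ℝ) (τ : ℝ) (u₀ : ℝ → ℝ → ℝ) (ε : ℝ) (w : ℝ → ℝ → ℝ) :
    ℝ → ℝ → ℝ := fun x t =>
  u₀ x (max (-(2 * ε * τ)) (min t 0)) +
    ∫ s in (0 : ℝ)..max t 0, F ((w (x + ε) (s - ε * τ₀ x) - w x (s - ε * τ₀ x)) / ε)

/-- Picard iterates of `delayStep`, starting from the frozen initial datum. -/
noncomputable def delayIter (F τ₀ : ℝ → ℝ) (τ : ℝ) (u₀ : ℝ → ℝ → ℝ) (ε : ℝ) : ℕ → ℝ → ℝ → ℝ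
  | 0 => fun x t => u₀ x (max (-(2 * ε * τ)) (min t 0))
  | n + 1 => delayStep F τ₀ τ u₀ ε (delayIter F τ₀ τ u₀ ε n)

/-- The method of steps: on `(-∞, nεξ]` the solution is the `n`-th Picard iterate. -/
noncomputable def delayFlow (F τ₀ : ℝ → ℝ) (ξ τ : ℝ) (u₀ : ℝ → ℝ → ℝ) (ε : ℝ) : ℝ → ℝ → ℝ :=
  fun x t => delayIter F τ₀ τ u₀ ε ⌈t / (ε * ξ)⌉₊ x t

/-! ### Existence for the delay equation. -/

section Existence

variable {F τ₀ : ℝ → ℝ} {ξ τ ε : ℝ} {u₀ : ℝ → ℝ → ℝ}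

theorem continuous_frozen (hε : 0 < ε) (hτ : 0 < τ)
    (hu₀ : ∀ x, ContinuousOn (u₀ x) (Icc (-(2 * ε * τ)) 0)) (x : ℝ) :
    Continuous fun t => u₀ x (max (-(2 * ε * τ)) (min t 0)) := by
  refine (hu₀ x).comp_continuous (by fun_prop) fun t => ⟨le_max_left _ _, max_le ?_ (min_le_right _ _)⟩
  have : 0 < ε * τ := mul_pos hε hτ
  linarith

theorem continuous_delayStep (hF : Continuous F) (hε : 0 < ε) (hτ : 0 < τ)
    (hu₀ : ∀ x, ContinuousOn (u₀ x) (Icc (-(2 * ε * τ)) 0)) {w : ℝ → ℝ → ℝ}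
    (hw : ∀ x, Continuous (w x)) (x : ℝ) : Continuous (delayStep F τ₀ τ u₀ ε w x) := by
  refine (continuous_frozen hε hτ hu₀ x).add ?_
  have hc : Continuous fun s => F ((w (x + ε) (s - ε * τ₀ x) - w x (s - ε * τ₀ x)) / ε) := by
    have := hw x
    have := hw (x + ε)
    fun_prop
  exact (intervalIntegral.continuous_primitive (fun a b => hc.intervalIntegrable a b) 0).comp
    (by fun_prop : Continuous fun t : ℝ => max t 0)

/-- For `s ≤ t` the integrand reads `w` only up to time `a`, because the delay is at least `ε * ξ`.
Each Picard step therefore extends agreement by `ε * ξ`, and the iterates become stationary on every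
bounded time interval. -/
theorem delayStep_congr (hε : 0 < ε) (hτ₀ : ∀ x, ξ ≤ τ₀ x) {w v : ℝ → ℝ → ℝ} {a : ℝ}
    (h : ∀ x, ∀ t ≤ a, w x t = v x t) (x t : ℝ) (ht : t ≤ 0 ∨ t ≤ a + ε * ξ) :
    delayStep F τ₀ τ u₀ ε w x t = delayStep F τ₀ τ u₀ ε v x t := by
  unfold delayStep
  congr 1
  rcases le_or_gt t 0 with h0 | h0
  · simp [max_eq_right h0]
  · have hta : t ≤ a + ε * ξ := ht.resolve_left (not_le.2 h0)
    rw [max_eq_left h0.le]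
    refine intervalIntegral.integral_congr fun s hs => ?_
    rw [uIcc_of_le h0.le] at hs
    have : ε * ξ ≤ ε * τ₀ x := mul_le_mul_of_nonneg_left (hτ₀ x) hε.le
    have hsa : s - ε * τ₀ x ≤ a := by linarith [hs.2]
    simp only [h _ _ hsa]

theorem delayIter_succ_eq (hε : 0 < ε) (hτ₀ : ∀ x, ξ ≤ τ₀ x) (n : ℕ) (x t : ℝ)
    (ht : t ≤ n * (ε * ξ)) :
    delayIter F τ₀ τ u₀ ε (n + 1) x t = delayIter F τ₀ τ u₀ ε n x t := by
  induction n generalizing x t with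
  | zero =>
    have : t ≤ 0 := by simpa using ht
    simp [delayIter, delayStep, max_eq_right this]
  | succ n ih =>
    refine delayStep_congr hε hτ₀ (a := n * (ε * ξ)) ih x t (Or.inr ?_)
    push_cast at ht
    linarith

theorem delayIter_eq_of_le (hε : 0 < ε) (hξ : 0 < ξ) (hτ₀ : ∀ x, ξ ≤ τ₀ x) {n m : ℕ} (hnm : n ≤ m)
    (x t : ℝ) (ht : t ≤ n * (ε * ξ)) :
    delayIter F τ₀ τ u₀ ε m x t = delayIter F τ₀ τ u₀ ε n x t := by
  induction m, hnm using Nat.le_induction with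
  | base => rfl
  | succ m hm ih =>
    rw [delayIter_succ_eq hε hτ₀ m x t, ih]
    have : (n : ℝ) ≤ m := by exact_mod_cast hm
    have : (n : ℝ) * (ε * ξ) ≤ m * (ε * ξ) := mul_le_mul_of_nonneg_right this (by positivity)
    linarith

theorem delayFlow_eq (hε : 0 < ε) (hξ : 0 < ξ) (hτ₀ : ∀ x, ξ ≤ τ₀ x) (n : ℕ)
    (x t : ℝ) (ht : t ≤ n * (ε * ξ)) :
    delayFlow F τ₀ ξ τ u₀ ε x t = delayIter F τ₀ τ u₀ ε n x t := by
  have hp : 0 < ε * ξ := by positivity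
  unfold delayFlow
  refine (delayIter_eq_of_le hε hξ hτ₀ (Nat.ceil_le.2 ((div_le_iff₀ hp).2 ht)) x t ?_).symm
  exact (div_le_iff₀ hp).1 (Nat.le_ceil _)

theorem continuous_delayIter (hF : Continuous F) (hε : 0 < ε) (hτ : 0 < τ)
    (hu₀ : ∀ x, ContinuousOn (u₀ x) (Icc (-(2 * ε * τ)) 0)) (n : ℕ) (x : ℝ) :
    Continuous (delayIter F τ₀ τ u₀ ε n x) := by
  induction n generalizing x with
  | zero => exact continuous_frozen hε hτ hu₀ x
  | succ n ih => exact continuous_delayStep hF hε hτ hu₀ ih x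

theorem continuous_delayFlow (hF : Continuous F) (hε : 0 < ε) (hξ : 0 < ξ) (hτ : 0 < τ)
    (hτ₀ : ∀ x, ξ ≤ τ₀ x) (hu₀ : ∀ x, ContinuousOn (u₀ x) (Icc (-(2 * ε * τ)) 0)) (x : ℝ) :
    Continuous (delayFlow F τ₀ ξ τ u₀ ε x) := by
  have hp : 0 < ε * ξ := by positivity
  refine continuous_iff_continuousAt.2 fun t => ?_
  obtain ⟨n, hn⟩ := exists_nat_gt (t / (ε * ξ))
  rw [div_lt_iff₀ hp] at hn
  refine (continuous_delayIter (τ₀ := τ₀) hF hε hτ hu₀ n x).continuousAt.congr ?_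
  filter_upwards [Iio_mem_nhds hn] with s hs
  exact (delayFlow_eq hε hξ hτ₀ n x s (le_of_lt hs)).symm

theorem delayStep_delayFlow (hε : 0 < ε) (hξ : 0 < ξ) (hτ₀ : ∀ x, ξ ≤ τ₀ x) (x t : ℝ) :
    delayStep F τ₀ τ u₀ ε (delayFlow F τ₀ ξ τ u₀ ε) x t = delayFlow F τ₀ ξ τ u₀ ε x t := by
  have hp : 0 < ε * ξ := by positivity
  obtain ⟨n, hn⟩ := exists_nat_gt (t / (ε * ξ))
  rw [div_lt_iff₀ hp] at hn
  rw [delayFlow_eq hε hξ hτ₀ (n + 1) x t (by push_cast; linarith)]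
  exact delayStep_congr hε hτ₀ (delayFlow_eq hε hξ hτ₀ n) x t (Or.inr (by linarith))

theorem isDelaySolution_delayFlow (hF : Continuous F) (hε : 0 < ε) (hξ : 0 < ξ) (hτ : 0 < τ)
    (hτ₀ : ∀ x, ξ ≤ τ₀ x) (hu₀ : ∀ x, ContinuousOn (u₀ x) (Icc (-(2 * ε * τ)) 0)) (T : EReal) :
    IsDelaySolution F τ₀ τ u₀ T ε (delayFlow F τ₀ ξ τ u₀ ε) where
  initial x s hs := by
    rw [← delayStep_delayFlow hε hξ hτ₀]
    simp [delayStep, max_eq_right hs.2, min_eq_left hs.2, max_eq_right hs.1]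
  continuousOn x := (continuous_delayFlow hF hε hξ hτ hτ₀ hu₀ x).continuousOn
  equation x t ht := by
    set w := delayFlow F τ₀ ξ τ u₀ ε with hw
    have hwc : ∀ x, Continuous (w x) := continuous_delayFlow hF hε hξ hτ hτ₀ hu₀
    have hc : Continuous fun s => F ((w (x + ε) (s - ε * τ₀ x) - w x (s - ε * τ₀ x)) / ε) := by
      have := hwc x
      have := hwc (x + ε)
      fun_prop
    have hd := (intervalIntegral.integral_hasDerivAt_right (hc.intervalIntegrable 0 t)
      (hc.stronglyMeasurableAtFilter _ _) hc.continuousAt).const_add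
        (u₀ x (max (-(2 * ε * τ)) 0))
    refine hd.congr_of_eventuallyEq ?_
    filter_upwards [Ioi_mem_nhds ht.1] with s hs
    have hs' : 0 ≤ s := le_of_lt hs
    rw [hw, ← delayStep_delayFlow hε hξ hτ₀]
    simp [delayStep, max_eq_left hs', min_eq_right hs']

end Existence

/-! ### Uniqueness, sign symmetry and growth for the delay equation. -/

section Uniqueness

variable {F τ₀ : ℝ → ℝ} {ξ τ ε : ℝ} {u₀ u v : ℝ → ℝ → ℝ} {T : EReal}

theorem IsDelaySolution.mono (h : IsDelaySolution F τ₀ τ u₀ T ε u) {S : EReal} (hS : S ≤ T) :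
    IsDelaySolution F τ₀ τ u₀ S ε u where
  initial := h.initial
  continuousOn x := (h.continuousOn x).mono fun _ ht => ⟨ht.1, ht.2.trans_le hS⟩
  equation x t ht := h.equation x t ⟨ht.1, ht.2.trans_le hS⟩

/-- This symmetry preserves monotonicity and the Lipschitz constant of `F`, so every upper estimate
yields a lower one. -/
theorem IsDelaySolution.neg (h : IsDelaySolution F τ₀ τ u₀ T ε u) :
    IsDelaySolution (fun p => -F (-p)) τ₀ τ (fun x t => -u₀ x t) T ε (fun x t => -u x t) where
  initial x s hs := by rw [h.initial x s hs]
  continuousOn x := (h.continuousOn x).neg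
  equation x t ht := by
    have e : ∀ a b : ℝ, -((-a - -b) / ε) = (a - b) / ε := fun a b => by ring
    simp only [e]
    exact (h.equation x t ht).neg

/-- The right-hand sides at times up to `(n + 1) * (ε * ξ)` read only values already known to agree,
so `v - u` is constant in time from `0` on. -/
theorem IsDelaySolution.eqOn_step (hε : 0 < ε) (hξ : 0 < ξ) (hτ₀ : ∀ x, τ₀ x ∈ Icc ξ τ)
    (hu : IsDelaySolution F τ₀ τ u₀ T ε u) (hv : IsDelaySolution F τ₀ τ u₀ T ε v) (n : ℕ) (x t : ℝ)
    (ht : t ∈ timeIco (-(2 * ε * τ)) T) (htn : t ≤ n * (ε * ξ)) : v x t = u x t := by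
  have hp : 0 < ε * ξ := by positivity
  induction n generalizing x t with
  | zero =>
    have h0 : t ≤ 0 := by simpa using htn
    rw [hu.initial x t ⟨ht.1, h0⟩, hv.initial x t ⟨ht.1, h0⟩]
  | succ n ih =>
    have hτp : 0 < τ := hξ.trans_le ((hτ₀ 0).1.trans (hτ₀ 0).2)
    have hετ : 0 < ε * τ := by positivity
    rcases le_or_gt t 0 with h0 | h0
    · rw [hu.initial x t ⟨ht.1, h0⟩, hv.initial x t ⟨ht.1, h0⟩]
    have hlt : ∀ s ≤ t, (s : EReal) < T := fun s hs => (EReal.coe_le_coe_iff.2 hs).trans_lt ht.2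
    have hcont : ContinuousOn (fun s => v x s - u x s) (Icc 0 t) :=
      ((hv.continuousOn x).sub (hu.continuousOn x)).mono fun s hs => ⟨hs.1, hlt s hs.2⟩
    have hder : ∀ s ∈ Ioo 0 t, HasDerivAt (fun s => v x s - u x s) 0 s := by
      intro s hs
      have hsT : s ∈ timeIoo 0 T := ⟨hs.1, hlt s hs.2.le⟩
      have h1 : ε * ξ ≤ ε * τ₀ x := mul_le_mul_of_nonneg_left (hτ₀ x).1 hε.le
      have h2 : ε * τ₀ x ≤ ε * τ := mul_le_mul_of_nonneg_left (hτ₀ x).2 hε.le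
      have hmem : s - ε * τ₀ x ∈ timeIco (-(2 * ε * τ)) T :=
        ⟨by linarith [hs.1], hlt _ (by linarith [hs.2])⟩
      have hle : s - ε * τ₀ x ≤ n * (ε * ξ) := by
        push_cast at htn
        linarith [hs.2]
      have := (hv.equation x s hsT).sub (hu.equation x s hsT)
      rwa [ih _ _ hmem hle, ih _ _ hmem hle, sub_self] at this
    obtain ⟨c, -, hc⟩ := exists_hasDerivAt_eq_slope _ _ h0 hcont hder
    have h00 : v x 0 = u x 0 := by
      rw [hu.initial x 0 ⟨by linarith, le_rfl⟩, hv.initial x 0 ⟨by linarith, le_rfl⟩]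
    rw [eq_comm, div_eq_zero_iff] at hc
    rcases hc with hc | hc <;> linarith

theorem IsDelaySolution.eqOn (hε : 0 < ε) (hξ : 0 < ξ) (hτ₀ : ∀ x, τ₀ x ∈ Icc ξ τ)
    (hu : IsDelaySolution F τ₀ τ u₀ T ε u) (hv : IsDelaySolution F τ₀ τ u₀ T ε v) (x t : ℝ)
    (ht : t ∈ timeIco (-(2 * ε * τ)) T) : v x t = u x t := by
  obtain ⟨n, hn⟩ := exists_nat_gt (t / (ε * ξ))
  rw [div_lt_iff₀ (by positivity)] at hn
  exact hu.eqOn_step hε hξ hτ₀ hv n x t ht hn.le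

/-- Independent of `ε`: it keeps the relaxed limits finite and fixes their value at `t = 0`. -/
theorem IsDelaySolution.abs_sub_le {M : ℝ} (hF : ∀ p, |F p| ≤ M) (hετ : 0 ≤ ε * τ)
    (hu : IsDelaySolution F τ₀ τ u₀ T ε u) (x t : ℝ) (ht : t ∈ timeIco 0 T) :
    |u x t - u₀ x 0| ≤ M * t := by
  rw [← hu.initial x 0 ⟨by linarith, le_rfl⟩]
  rcases ht.1.eq_or_lt with rfl | h0
  · simp
  have hlt : ∀ s ≤ t, (s : EReal) < T := fun s hs => (EReal.coe_le_coe_iff.2 hs).trans_lt ht.2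
  obtain ⟨c, -, hc⟩ := exists_hasDerivAt_eq_slope (u x) _ h0
    ((hu.continuousOn x).mono fun s hs => ⟨hs.1, hlt s hs.2⟩)
    fun s hs => hu.equation x s ⟨hs.1, hlt s hs.2.le⟩
  rw [sub_zero, eq_div_iff h0.ne'] at hc
  rw [← hc, abs_mul, abs_of_pos h0]
  exact mul_le_mul_of_nonneg_right (hF _) h0.le

end Uniqueness

/-! ### Growth and comparison for viscosity subsolutions. -/

theorem mul_le_sq_add {L k σ : ℝ} (hk : 0 < k) (h : L ^ 2 ≤ k * σ) (y : ℝ) :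
    L * y - k * y ^ 2 ≤ σ / 4 := by
  have h1 : 0 ≤ (2 * k * y - L) ^ 2 := sq_nonneg _
  have h2 : 0 ≤ k * (σ / 4 - (L * y - k * y ^ 2)) := by nlinarith
  have := nonneg_of_mul_nonneg_right h2 hk
  linarith

/-- The subsolution inequality at an interior maximum, for a test function that is the sum of a
function of `x` and a function of `t`. -/
theorem IsViscositySubsolution.le_of_isMaxOn {F : ℝ → ℝ} {T : EReal} {u : ℝ → ℝ → ℝ}
    (hu : IsViscositySubsolution F T u) {a b : ℝ → ℝ} (ha : ContDiff ℝ 1 a) (hb : ContDiff ℝ 1 b)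
    {x t a' b' : ℝ} (ha' : HasDerivAt a a' x) (hb' : HasDerivAt b b' t) (ht : t ∈ timeIoo 0 T)
    {S : Set (ℝ × ℝ)} (hS : S ∈ 𝓝 (x, t))
    (hmax : ∀ p ∈ S, u p.1 p.2 - (a p.1 + b p.2) ≤ u x t - (a x + b t)) : b' ≤ F a' := by
  have hφ : ContDiff ℝ 1 fun p : ℝ × ℝ => a p.1 + b p.2 :=
    (ha.comp contDiff_fst).add (hb.comp contDiff_snd)
  have h := hu _ hφ x t ht (by filter_upwards [hS] with p hp using hmax p hp)
  have h1 : HasFDerivAt (fun p : ℝ × ℝ => a p.1) (a' • ContinuousLinearMap.fst ℝ ℝ ℝ) (x, t) :=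
    HasDerivAt.comp_hasFDerivAt (x, t) ha' hasFDerivAt_fst
  have h2 : HasFDerivAt (fun p : ℝ × ℝ => b p.2) (b' • ContinuousLinearMap.snd ℝ ℝ ℝ) (x, t) :=
    HasDerivAt.comp_hasFDerivAt (x, t) hb' hasFDerivAt_snd
  rw [HasFDerivAt.fderiv (f := fun p : ℝ × ℝ => a p.1 + b p.2) (h1.add h2)] at h
  simpa using h

theorem hasDerivAt_exp_penalty (δ μ t₀ t : ℝ) :
    HasDerivAt (fun t => δ * Real.exp (μ * (t - t₀))) (δ * μ * Real.exp (μ * (t - t₀))) t := by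
  have := ((((hasDerivAt_id t).sub_const t₀).const_mul μ).exp).const_mul δ
  refine this.congr_deriv ?_
  simp only [id_eq]
  ring

/-- The time penalty costs only `δ` at `t₀` but more than `B` at `T₁`, which keeps maxima away from
the final time; its positive derivative makes the viscosity inequalities strict. -/
theorem le_exp_penalty {δ t₀ T₁ B : ℝ} (hδ : 0 < δ) (hT : t₀ < T₁) :
    B + δ ≤ δ * Real.exp (B / (δ * (T₁ - t₀)) * (T₁ - t₀)) := by
  have h : B / (δ * (T₁ - t₀)) * (T₁ - t₀) = B / δ := by
    have : T₁ - t₀ ≠ 0 := by linarith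
    field_simp
  rw [h]
  calc B + δ = δ * (B / δ + 1) := by field_simp
    _ ≤ _ := mul_le_mul_of_nonneg_left (Real.add_one_le_exp _) hδ.le

/-- A subsolution grows at most at the rate `sup F`. -/
theorem IsViscositySubsolution.le_add_mul {F g : ℝ → ℝ} {T : EReal} {u : ℝ → ℝ → ℝ} {M L : ℝ}
    (hF : ∀ p, F p ≤ M) (hM : 0 ≤ M) (hg : ∀ x y, g x ≤ g y + L * |x - y|)
    (hu : IsViscositySubsolution F T u)
    (husc : UpperSemicontinuousOn (fun p : ℝ × ℝ => u p.1 p.2) (univ ×ˢ timeIco 0 T))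
    (h0 : ∀ x, u x 0 ≤ g x) (x₀ t₀ : ℝ) (ht₀ : t₀ ∈ timeIco 0 T) : u x₀ t₀ ≤ g x₀ + M * t₀ := by
  by_contra! hcon
  obtain ⟨σ, hσ, hσu⟩ : ∃ σ, 0 < σ ∧ u x₀ t₀ = g x₀ + M * t₀ + σ :=
    ⟨u x₀ t₀ - (g x₀ + M * t₀), by linarith, by ring⟩
  have ht₀pos : 0 < t₀ := by
    rcases ht₀.1.eq_or_lt with rfl | h
    · linarith [h0 x₀]
    · exact h
  obtain ⟨T₁, hT₁, hT₁T⟩ := EReal.lt_iff_exists_real_btwn.1 ht₀.2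
  rw [EReal.coe_lt_coe_iff] at hT₁
  set K : Set (ℝ × ℝ) := Icc (x₀ - 1) (x₀ + 1) ×ˢ Icc 0 T₁ with hKdef
  have hK : IsCompact K := isCompact_Icc.prod isCompact_Icc
  have hKs : K ⊆ univ ×ˢ timeIco 0 T := fun p hp =>
    ⟨mem_univ _, hp.2.1, (EReal.coe_le_coe_iff.2 hp.2.2).trans_lt hT₁T⟩
  have huK := husc.mono hKs
  obtain ⟨B, hB⟩ := huK.bddAbove_of_isCompact hK
  have hBu : ∀ p ∈ K, u p.1 p.2 ≤ B := fun p hp => hB (mem_image_of_mem _ hp)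
  set D : ℝ := |B - g x₀| + 1 with hD
  have hDB : B ≤ g x₀ + D := by linarith [le_abs_self (B - g x₀)]
  have hDpos : 0 < D := by positivity
  -- The first term excludes a maximum at `t = 0` against the Lipschitz datum, the second one on the
  -- sides `|x - x₀| = 1`.
  set k : ℝ := L ^ 2 / σ + D with hk
  have hkpos : 0 < k := by positivity
  have hkL : L ^ 2 ≤ k * σ := by
    rw [hk, add_mul, div_mul_cancel₀ _ hσ.ne']
    have : 0 < D * σ := by positivity
    linarith
  have hkD : D ≤ k := by
    have : 0 ≤ L ^ 2 / σ := by positivity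
    linarith
  set δ : ℝ := σ / 4 with hδ
  have hδpos : 0 < δ := by positivity
  set μ : ℝ := D / (δ * (T₁ - t₀)) with hμ
  have hμpos : 0 < μ := div_pos hDpos (mul_pos hδpos (by linarith))
  have hpen : D + δ ≤ δ * Real.exp (μ * (T₁ - t₀)) := le_exp_penalty hδpos hT₁
  set a : ℝ → ℝ := fun x => k * (x - x₀) ^ 2 with ha
  set b : ℝ → ℝ := fun t => M * t + δ * Real.exp (μ * (t - t₀)) with hb
  have hac : ContDiff ℝ 1 a := by fun_prop
  have hbc : ContDiff ℝ 1 b := by fun_prop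
  have hcont : Continuous fun p : ℝ × ℝ => -(a p.1 + b p.2) := by
    have := hac.continuous
    have := hbc.continuous
    fun_prop
  have hx₀K : (x₀, t₀) ∈ K := ⟨⟨by simp, by simp⟩, ht₀.1, hT₁.le⟩
  obtain ⟨⟨x, t⟩, hmem, hmax⟩ := (huK.add
    (hcont.upperSemicontinuous.upperSemicontinuousOn K)).exists_isMaxOn ⟨_, hx₀K⟩ hK
  have hval : g x₀ + 3 * σ / 4 ≤ u x t - (a x + b t) := by
    have := hmax hx₀K
    simp only [mem_ofPred_eq] at this
    have h1 : a x₀ = 0 := by simp [ha]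
    have h2 : b t₀ = M * t₀ + δ := by simp [hb]
    rw [h1, h2] at this
    linarith
  obtain ⟨⟨hx1, hx2⟩, ht1, ht2⟩ := hmem
  simp only at hx1 hx2 ht1 ht2
  have haN : 0 ≤ a x := by positivity
  have heN : 0 < δ * Real.exp (μ * (t - t₀)) := by positivity
  have hMt : 0 ≤ M * t := mul_nonneg hM ht1
  have hbt : b t = M * t + δ * Real.exp (μ * (t - t₀)) := rfl
  have huB := hBu (x, t) ⟨⟨hx1, hx2⟩, ht1, ht2⟩
  simp only at huB
  have htpos : 0 < t := by
    rcases ht1.eq_or_lt with rfl | h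
    · exfalso
      have h1 := h0 x
      have h2 := hg x x₀
      have h3 := mul_le_sq_add hkpos hkL |x - x₀|
      rw [sq_abs] at h3
      have h4 : a x = k * (x - x₀) ^ 2 := rfl
      linarith
    · exact h
  have htT : t < T₁ := by
    rcases ht2.eq_or_lt with rfl | h
    · exfalso
      linarith
    · exact h
  have hxne : ∀ y, (y - x₀) ^ 2 = 1 → x ≠ y := by
    rintro y hy rfl
    have h4 : a x = k * (x - x₀) ^ 2 := rfl
    rw [hy] at h4
    linarith
  have hxl : x₀ - 1 < x := lt_of_le_of_ne hx1 (hxne _ (by ring)).symm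
  have hxr : x < x₀ + 1 := lt_of_le_of_ne hx2 (hxne _ (by ring))
  have hS : K ∈ 𝓝 (x, t) := prod_mem_nhds (Icc_mem_nhds hxl hxr) (Icc_mem_nhds htpos htT)
  have hb' : HasDerivAt b (M + δ * μ * Real.exp (μ * (t - t₀))) t := by
    have := ((hasDerivAt_id t).const_mul M).add (hasDerivAt_exp_penalty δ μ t₀ t)
    rw [mul_one] at this
    exact this
  have := hu.le_of_isMaxOn hac hbc (hac.differentiable one_ne_zero).differentiableAt.hasDerivAt hb'
    ⟨htpos, (EReal.coe_lt_coe_iff.2 htT).trans hT₁T⟩ hS fun p hp => by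
      have := hmax hp
      simp only [mem_ofPred_eq] at this
      linarith
  -- The viscosity inequality reads `M` plus this positive term `≤ F (deriv a x)`, which contradicts
  -- `F ≤ M`.
  have hpos : 0 < δ * μ * Real.exp (μ * (t - t₀)) := by positivity
  linarith [hF (deriv a x)]

theorem hasDerivAt_sqrt_one_add_sq (x₀ x : ℝ) :
    HasDerivAt (fun x => √(1 + (x - x₀) ^ 2)) ((x - x₀) / √(1 + (x - x₀) ^ 2)) x := by
  have h : HasDerivAt (fun x => 1 + (x - x₀) ^ 2) (2 * (x - x₀)) x := by
    have := (((hasDerivAt_id x).sub_const x₀).pow 2).const_add 1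
    simpa using this
  convert h.sqrt (by positivity) using 1
  field_simp

theorem contDiff_sqrt_one_add_sq (x₀ : ℝ) : ContDiff ℝ 1 fun x => √(1 + (x - x₀) ^ 2) :=
  ContDiff.sqrt (by fun_prop) fun x => by positivity

theorem abs_le_sqrt_one_add_sq (y : ℝ) : |y| ≤ √(1 + y ^ 2) :=
  Real.abs_le_sqrt (by linarith)

theorem abs_div_sqrt_one_add_sq_le (y : ℝ) : |y / √(1 + y ^ 2)| ≤ 1 := by
  rw [abs_div, abs_of_nonneg (Real.sqrt_nonneg _), div_le_one (by positivity)]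
  exact abs_le_sqrt_one_add_sq y

/-- Comparison principle: a subsolution `u` and a supersolution `-v` that stay within linear growth
in time of the same Lipschitz initial datum are ordered. -/
theorem IsViscositySubsolution.add_nonpos {F g : ℝ → ℝ} {CF : ℝ≥0} {T : EReal} {u v : ℝ → ℝ → ℝ}
    {M L : ℝ} (hF : LipschitzWith CF F) (hM : 0 ≤ M) (hg : ∀ x y, g x ≤ g y + L * |x - y|)
    (hu : IsViscositySubsolution F T u) (hv : IsViscositySubsolution (fun p => -F (-p)) T v)
    (huc : UpperSemicontinuousOn (fun p : ℝ × ℝ => u p.1 p.2) (univ ×ˢ timeIco 0 T))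
    (hvc : UpperSemicontinuousOn (fun p : ℝ × ℝ => v p.1 p.2) (univ ×ˢ timeIco 0 T))
    (hug : ∀ x, ∀ t ∈ timeIco 0 T, u x t ≤ g x + M * t)
    (hvg : ∀ x, ∀ t ∈ timeIco 0 T, v x t ≤ -g x + M * t)
    (x₀ t₀ : ℝ) (ht₀ : t₀ ∈ timeIco 0 T) : u x₀ t₀ + v x₀ t₀ ≤ 0 := by
  by_contra! hσ
  obtain ⟨σ, hσu⟩ : ∃ σ, σ = u x₀ t₀ + v x₀ t₀ := ⟨_, rfl⟩
  rw [← hσu] at hσ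
  have ht₀pos : 0 < t₀ := by
    rcases ht₀.1.eq_or_lt with rfl | h
    · linarith [hug x₀ _ ht₀, hvg x₀ _ ht₀]
    · exact h
  obtain ⟨T₁, hT₁, hT₁T⟩ := EReal.lt_iff_exists_real_btwn.1 ht₀.2
  rw [EReal.coe_lt_coe_iff] at hT₁
  have hI : ∀ t ∈ Icc 0 T₁, t ∈ timeIco 0 T := fun t ht =>
    ⟨ht.1, (EReal.coe_le_coe_iff.2 ht.2).trans_lt hT₁T⟩
  have hT₁pos : 0 < T₁ := ht₀pos.trans hT₁
  set D : ℝ := 2 * M * T₁ + 1 with hD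
  have hDpos : 0 < D := by positivity
  set δ : ℝ := σ / 8 with hδ
  have hδpos : 0 < δ := by positivity
  set μ : ℝ := D / (δ * (T₁ - t₀)) with hμ
  have hμpos : 0 < μ := div_pos hDpos (mul_pos hδpos (by linarith))
  have hpen : D + δ ≤ δ * Real.exp (μ * (T₁ - t₀)) := le_exp_penalty hδpos hT₁
  set η : ℝ := δ * μ * Real.exp (μ * (0 - t₀)) with hη
  have hηpos : 0 < η := by positivity
  -- `η` bounds the slope of the time penalty from below for `t ≥ 0`. The second entry makes the
  -- gradient error due to `β * w` smaller than this slope.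
  set β : ℝ := min (σ / 8) (η / (CF + 1)) with hβ
  have hβpos : 0 < β := lt_min (by positivity) (by positivity)
  have hβσ : β ≤ σ / 8 := min_le_left _ _
  have hβη : CF * β < η := by
    have h1 : (CF + 1 : ℝ) * β ≤ (CF + 1) * (η / (CF + 1)) :=
      mul_le_mul_of_nonneg_left (min_le_right _ _) (by positivity)
    rw [mul_div_cancel₀ _ (by positivity)] at h1
    linarith
  -- `k` stays fixed: `F` depends only on the gradient, so the doubled points need not merge.
  set k : ℝ := (L ^ 2 + M ^ 2) / σ + 1 with hk
  have hkpos : 0 < k := by positivity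
  have hkσ : k * σ = L ^ 2 + M ^ 2 + σ := by
    rw [hk, add_mul, div_mul_cancel₀ _ hσ.ne', one_mul]
  have hkL : L ^ 2 ≤ k * σ := by linarith [sq_nonneg M]
  have hkM : M ^ 2 ≤ k * σ := by linarith [sq_nonneg L]
  -- At distance `R` from `x₀` one has `β * w ≥ D`, so the maximum avoids the sides of the box.
  set R : ℝ := D / β with hR
  have hRpos : 0 < R := by positivity
  have hβR : β * R = D := by rw [hR]; field_simp
  set w : ℝ → ℝ := fun x => √(1 + (x - x₀) ^ 2) with hw
  set p : ℝ → ℝ := fun t => δ * Real.exp (μ * (t - t₀)) with hp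
  have hwc : ContDiff ℝ 1 w := contDiff_sqrt_one_add_sq x₀
  have hpc : ContDiff ℝ 1 p := by fun_prop
  have hppos : ∀ t, 0 < p t := fun t => by positivity
  have hwpos : ∀ x, 0 ≤ β * w x := fun x => by positivity
  set I : Set ℝ := Icc (x₀ - R) (x₀ + R) with hIdef
  set J : Set ℝ := Icc 0 T₁ with hJ
  set K : Set ((ℝ × ℝ) × (ℝ × ℝ)) := (I ×ˢ J) ×ˢ (I ×ˢ J) with hKdef
  have hK : IsCompact K :=
    (isCompact_Icc.prod isCompact_Icc).prod (isCompact_Icc.prod isCompact_Icc)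
  set ψ : (ℝ × ℝ) × (ℝ × ℝ) → ℝ := fun q => k * (q.1.1 - q.2.1) ^ 2 + k * (q.1.2 - q.2.2) ^ 2
    + p q.1.2 + p q.2.2 + β * w q.1.1 + β * w q.2.1 with hψ
  have hψc : Continuous ψ := by
    have := hwc.continuous
    have := hpc.continuous
    fun_prop
  have husc : UpperSemicontinuousOn
      (fun q : (ℝ × ℝ) × (ℝ × ℝ) => u q.1.1 q.1.2 + v q.2.1 q.2.2 + -ψ q) K := by
    refine (UpperSemicontinuousOn.add ?_ ?_).add (hψc.neg.upperSemicontinuous.upperSemicontinuousOn K)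
    · exact huc.comp continuous_fst.continuousOn fun q hq => ⟨mem_univ _, hI _ hq.1.2⟩
    · exact hvc.comp continuous_snd.continuousOn fun q hq => ⟨mem_univ _, hI _ hq.2.2⟩
  have hx₀K : (((x₀, t₀), (x₀, t₀)) : (ℝ × ℝ) × (ℝ × ℝ)) ∈ K := by
    have h1 : x₀ ∈ I := ⟨by linarith, by linarith⟩
    have h2 : t₀ ∈ J := ⟨ht₀.1, hT₁.le⟩
    exact ⟨⟨h1, h2⟩, h1, h2⟩
  obtain ⟨⟨⟨x, t⟩, y, s⟩, hmem, hmax⟩ := husc.exists_isMaxOn ⟨_, hx₀K⟩ hK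
  have hval : σ / 2 ≤ u x t + v y s - ψ ((x, t), (y, s)) := by
    have := hmax hx₀K
    simp only [mem_ofPred_eq] at this
    have h1 : ψ ((x₀, t₀), (x₀, t₀)) = 2 * δ + 2 * β := by
      simp [hψ, hp, hw]
      ring
    rw [h1, ← hσu] at this
    linarith
  have hψe : ψ ((x, t), (y, s)) = k * (x - y) ^ 2 + k * (t - s) ^ 2 + p t + p s
    + β * w x + β * w y := rfl
  rw [hψe] at hval
  obtain ⟨⟨hx, ht⟩, hy, hs⟩ := hmem
  simp only at hx ht hy hs
  have hgL : u x t + v y s ≤ L * |x - y| + M * t + M * s := by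
    linarith [hug x t (hI t ht), hvg y s (hI s hs), hg x y]
  have hLk := mul_le_sq_add hkpos hkL |x - y|
  rw [sq_abs] at hLk
  have hsq : 0 ≤ k * (t - s) ^ 2 := by positivity
  have hMt : M * t ≤ M * T₁ := mul_le_mul_of_nonneg_left ht.2 hM
  have hMs : M * s ≤ M * T₁ := mul_le_mul_of_nonneg_left hs.2 hM
  have hp1 := hppos t
  have hp2 := hppos s
  have hw1 := hwpos x
  have hw2 := hwpos y
  -- At `t = 0` the terms `L * |x - y|` and `M * s` each gain at most `σ / 4` over their quadratic
  -- penalties, while the maximum is at least `σ / 2` and `p` is positive.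
  have htpos : 0 < t := by
    rcases ht.1.eq_or_lt with rfl | h
    · exfalso
      have := mul_le_sq_add hkpos hkM s
      rw [show (0 - s) ^ 2 = s ^ 2 by ring] at hval
      linarith
    · exact h
  have hspos : 0 < s := by
    rcases hs.1.eq_or_lt with rfl | h
    · exfalso
      have := mul_le_sq_add hkpos hkM t
      rw [sub_zero] at hval
      linarith
    · exact h
  have hpT : D + δ ≤ p T₁ := hpen
  have htT : t < T₁ := by
    refine lt_of_le_of_ne ht.2 ?_
    rintro rfl
    linarith
  have hsT : s < T₁ := by
    refine lt_of_le_of_ne hs.2 ?_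
    rintro rfl
    linarith
  have hwR : ∀ z, |z - x₀| = R → D ≤ β * w z := by
    intro z hz
    rw [← hβR, ← hz]
    exact mul_le_mul_of_nonneg_left (abs_le_sqrt_one_add_sq _) hβpos.le
  have hlR : |x₀ - R - x₀| = R := by rw [sub_sub_cancel_left, abs_neg, abs_of_pos hRpos]
  have hrR : |x₀ + R - x₀| = R := by rw [add_sub_cancel_left, abs_of_pos hRpos]
  have hxne : ∀ z, |z - x₀| = R → x ≠ z := by
    rintro z hz rfl
    linarith [hwR _ hz]
  have hyne : ∀ z, |z - x₀| = R → y ≠ z := by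
    rintro z hz rfl
    linarith [hwR _ hz]
  have hSx : I ×ˢ J ∈ 𝓝 (x, t) := prod_mem_nhds
    (Icc_mem_nhds (lt_of_le_of_ne hx.1 (hxne _ hlR).symm) (lt_of_le_of_ne hx.2 (hxne _ hrR)))
    (Icc_mem_nhds htpos htT)
  have hSy : I ×ˢ J ∈ 𝓝 (y, s) := prod_mem_nhds
    (Icc_mem_nhds (lt_of_le_of_ne hy.1 (hyne _ hlR).symm) (lt_of_le_of_ne hy.2 (hyne _ hrR)))
    (Icc_mem_nhds hspos hsT)
  have hq : ∀ c z, HasDerivAt (fun z => k * (z - c) ^ 2) (k * (2 * (z - c))) z := by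
    intro c z
    have := (((hasDerivAt_id z).sub_const c).pow 2).const_mul k
    simpa using this
  have hqc : ∀ c, ContDiff ℝ 1 fun z => k * (z - c) ^ 2 := fun c => by fun_prop
  have hw' : ∀ z, HasDerivAt w ((z - x₀) / √(1 + (z - x₀) ^ 2)) z := hasDerivAt_sqrt_one_add_sq x₀
  have hp' : ∀ z, HasDerivAt p (δ * μ * Real.exp (μ * (z - t₀))) z := hasDerivAt_exp_penalty δ μ t₀
  have h1 := hu.le_of_isMaxOn ((hqc y).add (contDiff_const.mul hwc)) ((hqc s).add hpc)
    ((hq y x).add ((hw' x).const_mul β)) ((hq s t).add (hp' t))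
    ⟨htpos, (EReal.coe_lt_coe_iff.2 htT).trans hT₁T⟩ hSx fun q hq => by
      have := hmax (show (q, (y, s)) ∈ K from ⟨hq, hy, hs⟩)
      simp only [mem_ofPred_eq, hψ] at this
      linarith
  have h2 := hv.le_of_isMaxOn ((hqc x).add (contDiff_const.mul hwc)) ((hqc t).add hpc)
    ((hq x y).add ((hw' y).const_mul β)) ((hq t s).add (hp' s))
    ⟨hspos, (EReal.coe_lt_coe_iff.2 hsT).trans hT₁T⟩ hSy fun q hq => by
      have := hmax (show ((x, t), q) ∈ K from ⟨⟨hx, ht⟩, hq⟩)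
      simp only [mem_ofPred_eq, hψ] at this
      have e1 : (x - q.1) ^ 2 = (q.1 - x) ^ 2 := by ring
      have e2 : (t - q.2) ^ 2 = (q.2 - t) ^ 2 := by ring
      have e3 : (x - y) ^ 2 = (y - x) ^ 2 := by ring
      have e4 : (t - s) ^ 2 = (s - t) ^ 2 := by ring
      rw [e1, e2, e3, e4] at this
      linarith
  have hη' : ∀ z, 0 ≤ z → η ≤ δ * μ * Real.exp (μ * (z - t₀)) := fun z hz =>
    mul_le_mul_of_nonneg_left (Real.exp_le_exp.2 (mul_le_mul_of_nonneg_left (by linarith) hμpos.le))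
      (by positivity)
  have h3 := hη' t htpos.le
  have h4 := hη' s hspos.le
  set A := (x - x₀) / √(1 + (x - x₀) ^ 2)
  set A' := (y - x₀) / √(1 + (y - x₀) ^ 2)
  have hA : |A| ≤ 1 := abs_div_sqrt_one_add_sq_le _
  have hA' : |A'| ≤ 1 := abs_div_sqrt_one_add_sq_le _
  -- The quadratic terms cancel between the two gradients and leave `β * (A + A')`; hence `2 * η ≤ 2
  -- * CF * β`, against `hβη`.
  have h5 := hF.dist_le_mul (k * (2 * (x - y)) + β * A) (-(k * (2 * (y - x)) + β * A'))
  rw [Real.dist_eq, Real.dist_eq, show k * (2 * (x - y)) + β * A - -(k * (2 * (y - x)) + β * A')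
    = β * (A + A') by ring, abs_mul, abs_of_pos hβpos] at h5
  have h6 : |A + A'| ≤ 2 := (abs_add_le _ _).trans (by linarith)
  have h7 : (CF : ℝ) * (β * |A + A'|) ≤ CF * (β * 2) := by gcongr
  have h8 := (le_abs_self _).trans h5
  linarith

/-! ### Positivity for delayed differential inequalities. -/

theorem hasDerivAt_exp_mul (ν : ℝ) {f : ℝ → ℝ} {f' t : ℝ} (hf : HasDerivAt f f' t) :
    HasDerivAt (fun s => Real.exp (ν * s) * f s) (Real.exp (ν * t) * (f' + ν * f t)) t := by
  have := (((hasDerivAt_id t).const_mul ν).exp).mul hf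
  refine this.congr_deriv ?_
  simp only [id_eq]
  ring

theorem monotoneOn_Icc_of_hasDerivAt {f f' : ℝ → ℝ} {a b : ℝ}
    (hf : ∀ t ∈ Icc a b, HasDerivAt f (f' t) t) (hf' : ∀ t ∈ Icc a b, 0 ≤ f' t) :
    MonotoneOn f (Icc a b) := by
  refine monotoneOn_of_hasDerivWithinAt_nonneg (convex_Icc a b)
    (fun t ht => (hf t ht).continuousAt.continuousWithinAt)
    (fun t ht => (hf t (interior_subset ht)).hasDerivWithinAt) fun t ht => hf' t (interior_subset ht)

/-- A nonnegative function that decays at most at the exponential rate `ν` up to time `t₁` keeps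
doing so under the delayed inequality `f'(t) ≥ -κ f(t - d)`, as long as `κ e^{νd} ≤ ν`. -/
theorem monotoneOn_exp_mul_extend {f f' : ℝ → ℝ} {ν κ d a t₁ t₂ : ℝ} (hν : 0 < ν) (hκ : 0 ≤ κ)
    (hκν : κ * Real.exp (ν * d) ≤ ν) (had : a ≤ t₁ - d) (h12 : t₁ ≤ t₂) (h21 : t₂ ≤ t₁ + d)
    (hf : ∀ t ∈ Icc t₁ t₂, HasDerivAt f (f' t) t) (hf₁ : 0 ≤ f t₁)
    (hmono : MonotoneOn (fun s => Real.exp (ν * s) * f s) (Icc a t₁))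
    (hf' : ∀ t ∈ Icc t₁ t₂, -(κ * f (t - d)) ≤ f' t) :
    MonotoneOn (fun s => Real.exp (ν * s) * f s) (Icc a t₂) ∧ ∀ t ∈ Icc t₁ t₂, 0 ≤ f t := by
  have ha1 : a ≤ t₁ := by linarith
  -- Since `t - d ≤ t₁`, the known monotonicity bounds the past value by the exponential through `f
  -- t₁`, up to the factor `exp (ν * d)`.
  have hpast : ∀ t ∈ Icc t₁ t₂, κ * f (t - d) ≤ ν * (f t₁ * Real.exp (ν * (t₁ - t))) := by
    intro t ht
    have h := hmono (a := t - d) (b := t₁) ⟨by linarith [ht.1], by linarith [ht.2]⟩ ⟨ha1, le_rfl⟩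
      (by linarith [ht.2])
    have h1 : f (t - d) ≤ Real.exp (ν * d) * (f t₁ * Real.exp (ν * (t₁ - t))) := by
      have h2 := mul_le_mul_of_nonneg_left h (Real.exp_pos (-(ν * (t - d)))).le
      simp only [← mul_assoc, ← Real.exp_add] at h2
      rw [neg_add_cancel, Real.exp_zero, one_mul] at h2
      rw [mul_left_comm, ← Real.exp_add, mul_comm (f t₁),
        show ν * d + ν * (t₁ - t) = -(ν * (t - d)) + ν * t₁ by ring]
      exact h2
    calc κ * f (t - d) ≤ κ * (Real.exp (ν * d) * (f t₁ * Real.exp (ν * (t₁ - t)))) :=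
          mul_le_mul_of_nonneg_left h1 hκ
      _ = κ * Real.exp (ν * d) * (f t₁ * Real.exp (ν * (t₁ - t))) := by ring
      _ ≤ _ := mul_le_mul_of_nonneg_right hκν (by positivity)
  -- By `hpast`, `f'` is at least the derivative of this exponential. The lower bound then upgrades
  -- `hpast` to `f' ≥ -ν * f`, so the decay property propagates.
  have hlow : ∀ t ∈ Icc t₁ t₂, f t₁ * Real.exp (ν * (t₁ - t)) ≤ f t := by
    have hm : MonotoneOn (fun t => f t - f t₁ * Real.exp (ν * (t₁ - t))) (Icc t₁ t₂) := by
      refine monotoneOn_Icc_of_hasDerivAt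
        (f' := fun t => f' t + ν * (f t₁ * Real.exp (ν * (t₁ - t)))) (fun t ht => ?_)
        fun t ht => by linarith [hf' t ht, hpast t ht]
      have := (hf t ht).sub (((((hasDerivAt_id t).const_sub t₁).const_mul ν).exp).const_mul (f t₁))
      refine this.congr_deriv ?_
      simp only [id_eq]
      ring
    intro t ht
    have := hm ⟨le_rfl, h12⟩ ht ht.1
    simp only [sub_self, mul_zero, Real.exp_zero, mul_one] at this
    linarith
  have hnn : ∀ t ∈ Icc t₁ t₂, 0 ≤ f t := fun t ht => le_trans (by positivity) (hlow t ht)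
  refine ⟨?_, hnn⟩
  have hm2 : MonotoneOn (fun s => Real.exp (ν * s) * f s) (Icc t₁ t₂) := by
    refine monotoneOn_Icc_of_hasDerivAt (fun t ht => hasDerivAt_exp_mul ν (hf t ht)) fun t ht => ?_
    refine mul_nonneg (Real.exp_pos _).le ?_
    have := mul_le_mul_of_nonneg_left (hlow t ht) hν.le
    linarith [hf' t ht, hpast t ht]
  have := hmono.union_right hm2 (isGreatest_Icc ha1) (isLeast_Icc h12)
  rwa [Icc_union_Icc_eq_Icc ha1 h12] at this

/-- Positivity for a delayed differential inequality coupled to the right neighbour. -/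
theorem nonneg_of_delayed_inequality {W W' : ℝ → ℝ → ℝ} {d : ℝ → ℝ} {ν κ ε h xl xm a t₁ b : ℝ}
    (hν : 0 < ν) (hκ : 0 ≤ κ) (hε : 0 ≤ ε) (hh : 0 < h) (hdh : ∀ x, h ≤ d x)
    (hκν : ∀ x, κ * Real.exp (ν * d x) ≤ ν) (had : ∀ x, a ≤ t₁ - d x) (h1b : t₁ ≤ b)
    (hW : ∀ x ∈ Icc xl xm, ∀ t ∈ Icc t₁ b, HasDerivAt (W x) (W' x t) t)
    (hineq : ∀ x ∈ Icc xl xm, ∀ t ∈ Icc t₁ b, 0 ≤ W (x + ε) (t - d x) → 0 ≤ W x (t - d x) →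
      -(κ * W x (t - d x)) ≤ W' x t)
    (hright : ∀ x ∈ Icc xm (xm + ε), ∀ t ∈ Icc a b, 0 ≤ W x t)
    (hinit : ∀ x ∈ Icc xl xm, ∀ t ∈ Icc a t₁, 0 ≤ W x t)
    (hmono : ∀ x ∈ Icc xl xm, MonotoneOn (fun s => Real.exp (ν * s) * W x s) (Icc a t₁)) :
    ∀ x ∈ Icc xl xm, ∀ t ∈ Icc a b, 0 ≤ W x t := by
  have key : ∀ n : ℕ, (∀ x ∈ Icc xl xm, ∀ t ∈ Icc a (min b (t₁ + n * h)), 0 ≤ W x t) ∧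
      ∀ x ∈ Icc xl xm,
        MonotoneOn (fun s => Real.exp (ν * s) * W x s) (Icc a (min b (t₁ + n * h))) := by
    intro n
    induction n with
    | zero => simpa [min_eq_right h1b] using And.intro hinit hmono
    | succ n ih =>
      set p := min b (t₁ + n * h) with hp
      set q := min b (t₁ + (n + 1 : ℕ) * h) with hq
      have hnh : 0 ≤ n * h := by positivity
      have hpq : p ≤ q := min_le_min_left _ (by push_cast; linarith)
      -- A time step no longer than the smallest delay keeps all delayed times at or before `p`.
      have hqp : q ≤ p + h := by
        rw [hp, min_add]
        exact min_le_min (by linarith) (by push_cast; linarith)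
      have h1p : t₁ ≤ p := le_min h1b (by linarith)
      have hqb : q ≤ b := min_le_left _ _
      have step : ∀ x ∈ Icc xl xm, MonotoneOn (fun s => Real.exp (ν * s) * W x s) (Icc a q) ∧
          ∀ t ∈ Icc p q, 0 ≤ W x t := by
        intro x hx
        have hdx := hdh x
        have hax := had x
        refine monotoneOn_exp_mul_extend (f' := W' x) (d := d x) hν hκ (hκν x) (by linarith) hpq
          (by linarith) (fun t ht => hW x hx t ⟨h1p.trans ht.1, ht.2.trans hqb⟩)
          (ih.1 x hx p ⟨by linarith, le_rfl⟩) (ih.2 x hx) fun t ht => ?_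
        have hpast : t - d x ∈ Icc a p := ⟨by linarith [ht.1], by linarith [ht.2]⟩
        refine hineq x hx t ⟨h1p.trans ht.1, ht.2.trans hqb⟩ ?_ (ih.1 x hx _ hpast)
        rcases le_total (x + ε) xm with hxm | hxm
        · exact ih.1 _ ⟨by linarith [hx.1], hxm⟩ _ hpast
        · exact hright _ ⟨hxm, by linarith [hx.2]⟩ _ ⟨hpast.1, hpast.2.trans (min_le_left _ _)⟩
      refine ⟨fun x hx t ht => ?_, fun x hx => (step x hx).1⟩
      rcases le_total t p with htp | htp
      · exact ih.1 x hx t ⟨ht.1, htp⟩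
      · exact (step x hx).2 t ⟨htp, ht.2⟩
  intro x hx t ht
  obtain ⟨n, hn⟩ := exists_nat_gt ((b - t₁) / h)
  rw [div_lt_iff₀ hh] at hn
  exact (key n).1 x hx t ⟨ht.1, le_min ht.2 (by linarith [ht.2])⟩

/-! ### Local comparison with a smooth supersolution. -/

theorem hasDerivAt_fst_line {ψ : ℝ × ℝ → ℝ} (hψ : ContDiff ℝ 1 ψ) (x t : ℝ) :
    HasDerivAt (fun y => ψ (y, t)) (fderiv ℝ ψ (x, t) (1, 0)) x :=
  (hψ.differentiable one_ne_zero (x, t)).hasFDerivAt.comp_hasDerivAt x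
    ((hasDerivAt_id x).prodMk (hasDerivAt_const x t))

theorem hasDerivAt_snd_line {ψ : ℝ × ℝ → ℝ} (hψ : ContDiff ℝ 1 ψ) (x t : ℝ) :
    HasDerivAt (fun s => ψ (x, s)) (fderiv ℝ ψ (x, t) (0, 1)) t :=
  (hψ.differentiable one_ne_zero (x, t)).hasFDerivAt.comp_hasDerivAt t
    ((hasDerivAt_const t x).prodMk (hasDerivAt_id t))

/-- Local comparison of a solution of the delayed equation with a smooth supersolution `ψ` of the
limit equation, given a gap on the boundary layer of a square. -/
theorem IsDelaySolution.add_le_of_supersolution {F τ₀ : ℝ → ℝ} {CF : ℝ≥0} {ξ τ ε M N c r x t : ℝ}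
    {u₀ u : ℝ → ℝ → ℝ} {ψ : ℝ × ℝ → ℝ} (hFmono : Monotone F) (hF : LipschitzWith CF F)
    (hFM : ∀ p, F p ≤ M) (hξ : 0 < ξ) (hτ₀ : ∀ x, τ₀ x ∈ Icc ξ τ)
    (hτ : Real.exp 1 * CF * τ ≤ 1) (hε : 0 < ε) (hu : IsDelaySolution F τ₀ τ u₀ ⊤ ε u)
    (hψ : ContDiff ℝ 1 ψ) (hrt : r < t)
    (hstrict : ∀ p ∈ Icc (x - r) (x + r) ×ˢ Icc (t - r) (t + r),
      ∀ q ∈ Icc (x - r) (x + r) ×ˢ Icc (t - r) (t + r),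
        F (fderiv ℝ ψ q (1, 0)) ≤ fderiv ℝ ψ p (0, 1))
    (hN : ∀ p ∈ Icc (x - r) (x + r) ×ˢ Icc (t - r) (t + r), -N ≤ fderiv ℝ ψ p (0, 1))
    (hlayer : ∀ p ∈ Icc (x - r) (x + r) ×ˢ Icc (t - r) (t + r),
      r / 2 ≤ |p.1 - x| ∨ r / 2 ≤ |p.2 - t| → u p.1 p.2 + 2 * c ≤ ψ p)
    (hεr : ε ≤ r / 2) (hετr : ε * τ ≤ r / 2) (hεc : (N + M) * (ε * τ) ≤ c) (hc : 0 ≤ c)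
    (y s : ℝ) (hy : y ∈ Icc (x - r / 2) (x + r / 2)) (hs : s ∈ Icc (t - r) (t + r / 2)) :
    u y s + c ≤ ψ (y, s) := by
  have hτpos : 0 < τ := hξ.trans_le ((hτ₀ 0).1.trans (hτ₀ 0).2)
  have hετ : 0 < ε * τ := by positivity
  set d : ℝ → ℝ := fun x => ε * τ₀ x with hd
  have hdξ : ∀ x, ε * ξ ≤ d x := fun x => mul_le_mul_of_nonneg_left (hτ₀ x).1 hε.le
  have hdτ : ∀ x, d x ≤ ε * τ := fun x => mul_le_mul_of_nonneg_left (hτ₀ x).2 hε.le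
  -- This rate minimises `exp (ν * d) / ν` for the longest delay `d = ε * τ`.
  set ν : ℝ := 1 / (ε * τ) with hν
  have hνpos : 0 < ν := by positivity
  set W : ℝ → ℝ → ℝ := fun y s => ψ (y, s) - u y s - c with hW
  set W' : ℝ → ℝ → ℝ := fun y s => fderiv ℝ ψ (y, s) (0, 1)
    - F ((u (y + ε) (s - ε * τ₀ y) - u y (s - ε * τ₀ y)) / ε) with hW'
  have hder : ∀ y, ∀ s ∈ Icc (t - r) (t + r / 2), HasDerivAt (W y) (W' y s) s := fun y s hs =>
    ((hasDerivAt_snd_line hψ y s).sub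
      (hu.equation y s ⟨by linarith [hs.1], EReal.coe_lt_top s⟩)).sub_const c
  have hlay : ∀ y ∈ Icc (x - r) (x + r), ∀ s ∈ Icc (t - r) (t + r),
      r / 2 ≤ |y - x| ∨ r / 2 ≤ |s - t| → c ≤ W y s := by
    intro y hy s hs h
    have := hlayer (y, s) ⟨hy, hs⟩ h
    simp only [hW]
    simp only at this
    linarith
  have hbot : ∀ y ∈ Icc (x - r / 2) (x + r / 2), ∀ s ∈ Icc (t - r) (t - r / 2), c ≤ W y s := by
    intro y hy s hs
    refine hlay y ⟨by linarith [hy.1], by linarith [hy.2]⟩ s ⟨hs.1, by linarith [hs.2]⟩ (Or.inr ?_)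
    rw [abs_sub_comm]
    exact (by linarith [hs.2] : r / 2 ≤ t - s).trans (le_abs_self _)
  suffices h : 0 ≤ W y s by
    simp only [hW] at h
    linarith
  -- Only the bottom and right parts of the layer are needed, since the difference quotient looks to
  -- the right.
  refine nonneg_of_delayed_inequality (W' := W') (d := d) (ν := ν) (κ := CF / ε) (ε := ε)
    (h := ε * ξ) (t₁ := t - r / 2) (a := t - r) (b := t + r / 2) hνpos (by positivity) hε.le
    (by positivity) hdξ (fun x => ?_) (fun x => by linarith [hdτ x]) (by linarith)
    (fun y _ s hs => hder y s ⟨by linarith [hs.1], hs.2⟩) (fun y hy s hs h1 h2 => ?_)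
    (fun y hy s hs => hc.trans (hlay y ⟨by linarith [hy.1], by linarith [hy.2]⟩ s
      ⟨hs.1, by linarith [hs.2]⟩ (Or.inl ?_)))
    (fun y hy s hs => hc.trans (hbot y hy s hs)) (fun y hy => ?_) y hy s hs
  · have h1 : ν * d x ≤ 1 := by
      rw [hν, one_div, inv_mul_le_iff₀ hετ, mul_one]
      exact hdτ x
    calc CF / ε * Real.exp (ν * d x) ≤ CF / ε * Real.exp 1 :=
          mul_le_mul_of_nonneg_left (Real.exp_le_exp.2 h1) (by positivity)
      _ = Real.exp 1 * CF * τ / (ε * τ) := by field_simp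
      _ ≤ ν := div_le_div_of_nonneg_right hτ hετ.le
  · have hdy := hdξ y
    have hdy' := hdτ y
    have hεξ : 0 < ε * ξ := by positivity
    have hline : ∀ z, HasDerivAt (fun z => ψ (z, s - d y)) (fderiv ℝ ψ (z, s - d y) (1, 0)) z :=
      fun z => hasDerivAt_fst_line hψ z (s - d y)
    obtain ⟨z, hz, hzs⟩ := exists_hasDerivAt_eq_slope _ _ (by linarith : y < y + ε)
      (fun z _ => (hline z).continuousAt.continuousWithinAt) fun z _ => hline z
    rw [add_sub_cancel_left] at hzs
    -- The quotient of `u` is that of `ψ` minus that of `W`; the term `W (y + ε)` is dropped by its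
    -- sign.
    have hquot : (u (y + ε) (s - d y) - u y (s - d y)) / ε
        ≤ fderiv ℝ ψ (z, s - d y) (1, 0) + W y (s - d y) / ε := by
      rw [hzs, ← add_div]
      refine div_le_div_of_nonneg_right ?_ hε.le
      simp only [hW] at h1 ⊢
      linarith
    have hlip : F (fderiv ℝ ψ (z, s - d y) (1, 0) + W y (s - d y) / ε)
        ≤ F (fderiv ℝ ψ (z, s - d y) (1, 0)) + CF / ε * W y (s - d y) := by
      have h := hF.dist_le_mul (fderiv ℝ ψ (z, s - d y) (1, 0) + W y (s - d y) / ε)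
        (fderiv ℝ ψ (z, s - d y) (1, 0))
      rw [Real.dist_eq, Real.dist_eq, add_sub_cancel_left, abs_of_nonneg (div_nonneg h2 hε.le)] at h
      have h' := (le_abs_self _).trans h
      have e : (CF : ℝ) * (W y (s - d y) / ε) = CF / ε * W y (s - d y) := by ring
      linarith
    have hst := hstrict (y, s) ⟨⟨by linarith [hy.1], by linarith [hy.2]⟩,
      by linarith [hs.1], by linarith [hs.2]⟩ (z, s - d y) ⟨⟨by linarith [hy.1, hz.1],
        by linarith [hy.2, hz.2]⟩, by linarith [hs.1], by linarith [hs.2]⟩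
    have := hFmono hquot
    simp only [hW']
    linarith
  · exact (by linarith [hy.1] : r / 2 ≤ y - x).trans (le_abs_self _)
  -- In the bottom layer `W ≥ c` and `W' ≥ -N - M`, while `ν * c ≥ N + M` by `hεc`; this starts the
  -- exponential estimate.
  · refine monotoneOn_Icc_of_hasDerivAt
      (fun s hs => hasDerivAt_exp_mul ν (hder y s ⟨hs.1, by linarith [hs.2]⟩)) fun s hs =>
        mul_nonneg (Real.exp_pos _).le ?_
    have h1 : ν * c ≤ ν * W y s := mul_le_mul_of_nonneg_left (hbot y hy s hs) hνpos.le
    have h2 : N + M ≤ ν * c := by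
      rw [hν, one_div, inv_mul_eq_div, le_div_iff₀ hετ]
      exact hεc
    have h3 : -N ≤ fderiv ℝ ψ (y, s) (0, 1) := hN (y, s)
      ⟨⟨by linarith [hy.1], by linarith [hy.2]⟩, hs.1, by linarith [hs.2]⟩
    have h4 : -N - M ≤ W' y s := by
      simp only [hW']
      linarith [hFM ((u (y + ε) (s - ε * τ₀ y) - u y (s - ε * τ₀ y)) / ε)]
    linarith

/-! ### Half-relaxed limits. -/

/-- The upper half-relaxed limit of `w ε` as `ε → 0⁺`. -/
noncomputable def relaxedLimsup (w : ℝ → ℝ → ℝ → ℝ) (x t : ℝ) : ℝ :=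
  -- Clamping the time at `0` permits full neighbourhoods of initial points, where `w` is controlled
  -- only for nonnegative times.
  limsup (fun q : ℝ × (ℝ × ℝ) => w q.1 q.2.1 (max q.2.2 0)) (𝓝[>] 0 ×ˢ 𝓝 (x, t))

section Relaxed

variable {w : ℝ → ℝ → ℝ → ℝ} {g : ℝ → ℝ} {M : ℝ}

theorem eventually_abs_sub_le_of_bound
    (hw : ∀ ε ∈ Ioc (0 : ℝ) 1, ∀ x, ∀ t, 0 ≤ t → |w ε x t - g x| ≤ M * t) (p : ℝ × ℝ) :
    ∀ᶠ q : ℝ × (ℝ × ℝ) in 𝓝[>] 0 ×ˢ 𝓝 p,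
      |w q.1 q.2.1 (max q.2.2 0) - g q.2.1| ≤ M * max q.2.2 0 := by
  have h : ∀ᶠ ε : ℝ in 𝓝[>] 0, ε ∈ Ioc (0 : ℝ) 1 := Ioc_mem_nhdsGT one_pos
  filter_upwards [h.prod_inl _] with q hq using hw _ hq _ _ (le_max_right _ _)

theorem eventually_relaxed_bounds (hg : Continuous g)
    (hw : ∀ ε ∈ Ioc (0 : ℝ) 1, ∀ x, ∀ t, 0 ≤ t → |w ε x t - g x| ≤ M * t) (x t : ℝ) {η : ℝ}
    (hη : 0 < η) :
    ∀ᶠ q : ℝ × (ℝ × ℝ) in 𝓝[>] 0 ×ˢ 𝓝 (x, t),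
      g x - M * max t 0 - η < w q.1 q.2.1 (max q.2.2 0) ∧
        w q.1 q.2.1 (max q.2.2 0) < g x + M * max t 0 + η := by
  have h1 : ∀ᶠ p : ℝ × ℝ in 𝓝 (x, t), g p.1 + M * max p.2 0 < g x + M * max t 0 + η :=
    ContinuousAt.eventually_lt (by fun_prop) (by fun_prop) (by simpa using hη)
  have h2 : ∀ᶠ p : ℝ × ℝ in 𝓝 (x, t), g x - M * max t 0 - η < g p.1 - M * max p.2 0 :=
    ContinuousAt.eventually_lt (by fun_prop) (by fun_prop) (by simpa using hη)
  filter_upwards [eventually_abs_sub_le_of_bound hw (x, t), h1.prod_inr _, h2.prod_inr _]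
    with q hq hq1 hq2
  rw [abs_le] at hq
  constructor <;> linarith

theorem isBoundedUnder_relaxed (hg : Continuous g)
    (hw : ∀ ε ∈ Ioc (0 : ℝ) 1, ∀ x, ∀ t, 0 ≤ t → |w ε x t - g x| ≤ M * t) (x t : ℝ) :
    (𝓝[>] 0 ×ˢ 𝓝 (x, t)).IsBoundedUnder (· ≤ ·)
      (fun q : ℝ × (ℝ × ℝ) => w q.1 q.2.1 (max q.2.2 0)) :=
  isBoundedUnder_of_eventually_le
    ((eventually_relaxed_bounds hg hw x t one_pos).mono fun _ h => h.2.le)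

theorem isCoboundedUnder_relaxed (hg : Continuous g)
    (hw : ∀ ε ∈ Ioc (0 : ℝ) 1, ∀ x, ∀ t, 0 ≤ t → |w ε x t - g x| ≤ M * t) (x t : ℝ) :
    (𝓝[>] 0 ×ˢ 𝓝 (x, t)).IsCoboundedUnder (· ≤ ·)
      (fun q : ℝ × (ℝ × ℝ) => w q.1 q.2.1 (max q.2.2 0)) :=
  (isBoundedUnder_of_eventually_ge
    ((eventually_relaxed_bounds hg hw x t one_pos).mono fun _ h => h.1.le)).isCoboundedUnder_le

theorem eventually_lt_of_relaxedLimsup_lt (hg : Continuous g)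
    (hw : ∀ ε ∈ Ioc (0 : ℝ) 1, ∀ x, ∀ t, 0 ≤ t → |w ε x t - g x| ≤ M * t) {x t a : ℝ}
    (h : relaxedLimsup w x t < a) :
    ∀ᶠ q : ℝ × (ℝ × ℝ) in 𝓝[>] 0 ×ˢ 𝓝 (x, t), w q.1 q.2.1 (max q.2.2 0) < a :=
  eventually_lt_of_limsup_lt h (isBoundedUnder_relaxed hg hw x t)

theorem relaxedLimsup_le_of_eventually (hg : Continuous g)
    (hw : ∀ ε ∈ Ioc (0 : ℝ) 1, ∀ x, ∀ t, 0 ≤ t → |w ε x t - g x| ≤ M * t) {x t a : ℝ}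
    (h : ∀ᶠ q : ℝ × (ℝ × ℝ) in 𝓝[>] 0 ×ˢ 𝓝 (x, t), w q.1 q.2.1 (max q.2.2 0) ≤ a) :
    relaxedLimsup w x t ≤ a :=
  limsup_le_of_le (isCoboundedUnder_relaxed hg hw x t) h

theorem upperSemicontinuous_relaxedLimsup (hg : Continuous g)
    (hw : ∀ ε ∈ Ioc (0 : ℝ) 1, ∀ x, ∀ t, 0 ≤ t → |w ε x t - g x| ≤ M * t) :
    UpperSemicontinuous fun p : ℝ × ℝ => relaxedLimsup w p.1 p.2 := by
  rintro ⟨x, t⟩ a ha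
  obtain ⟨b, hb, hba⟩ := exists_between ha
  obtain ⟨U, hU, V, hV, hUV⟩ :=
    mem_prod_iff.1 (eventually_lt_of_relaxedLimsup_lt hg hw hb)
  filter_upwards [eventually_mem_nhds_iff.2 hV] with p hp
  refine (relaxedLimsup_le_of_eventually hg hw ?_).trans_lt hba
  filter_upwards [prod_mem_prod hU hp] with q hq using (hUV hq).le

theorem relaxedLimsup_le_add (hg : Continuous g)
    (hw : ∀ ε ∈ Ioc (0 : ℝ) 1, ∀ x, ∀ t, 0 ≤ t → |w ε x t - g x| ≤ M * t) (x t : ℝ) (ht : 0 ≤ t) :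
    relaxedLimsup w x t ≤ g x + M * t := by
  refine le_of_forall_pos_le_add fun η hη => relaxedLimsup_le_of_eventually hg hw ?_
  filter_upwards [eventually_relaxed_bounds hg hw x t hη] with q hq
  rw [max_eq_left ht] at hq
  exact hq.2.le

theorem neg_bound (hw : ∀ ε ∈ Ioc (0 : ℝ) 1, ∀ x, ∀ t, 0 ≤ t → |w ε x t - g x| ≤ M * t) :
    ∀ ε ∈ Ioc (0 : ℝ) 1, ∀ x, ∀ t, 0 ≤ t → |(-w ε x t) - (-g x)| ≤ M * t := by
  intro ε hε x t ht
  rw [← neg_sub', abs_neg]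
  exact hw ε hε x t ht

/-- The lower relaxed limit, minus the second term, never exceeds the upper one. Comparison supplies
the opposite inequality. -/
theorem relaxedLimsup_add_neg_nonneg (hg : Continuous g)
    (hw : ∀ ε ∈ Ioc (0 : ℝ) 1, ∀ x, ∀ t, 0 ≤ t → |w ε x t - g x| ≤ M * t) (x t : ℝ) :
    0 ≤ relaxedLimsup w x t + relaxedLimsup (fun ε x t => -w ε x t) x t := by
  by_contra! h
  obtain ⟨a, ha, ha'⟩ := exists_between
    (by linarith : relaxedLimsup w x t < -relaxedLimsup (fun ε x t => -w ε x t) x t)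
  have h1 := eventually_lt_of_relaxedLimsup_lt hg hw ha
  have h2 := eventually_lt_of_relaxedLimsup_lt hg.neg (neg_bound hw)
    (by linarith : relaxedLimsup (fun ε x t => -w ε x t) x t < -a)
  obtain ⟨q, hq1, hq2⟩ := (h1.and h2).exists
  linarith

end Relaxed

/-- Uniform control on a compact set by a continuous function above the relaxed limit. -/
theorem eventually_forall_lt_of_relaxedLimsup_lt {w : ℝ → ℝ → ℝ → ℝ} {g : ℝ → ℝ} {M : ℝ}
    (hg : Continuous g)
    (hw : ∀ ε ∈ Ioc (0 : ℝ) 1, ∀ x, ∀ t, 0 ≤ t → |w ε x t - g x| ≤ M * t) {K : Set (ℝ × ℝ)}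
    (hK : IsCompact K) {ψ : ℝ × ℝ → ℝ} (hψ : Continuous ψ)
    (h : ∀ p ∈ K, relaxedLimsup w p.1 p.2 < ψ p) :
    ∀ᶠ ε in 𝓝[>] 0, ∀ p ∈ K, w ε p.1 (max p.2 0) < ψ p := by
  rw [eventually_nhdsWithin_iff]
  have := hK.eventually_forall_of_forall_eventually (x₀ := (0 : ℝ))
    (P := fun ε p => ε ∈ Ioi (0 : ℝ) → w ε p.1 (max p.2 0) < ψ p) fun p hp => ?_
  · exact this.mono fun ε hε hpos p hp => hε p hp hpos
  · obtain ⟨b, hb, hbψ⟩ := exists_between (h p hp)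
    have h1 := eventually_lt_of_relaxedLimsup_lt hg hw hb
    have h2 : ∀ᶠ q in 𝓝 p, b < ψ q := hψ.continuousAt.eventually_const_lt hbψ
    have h3 : ∀ᶠ q : ℝ × (ℝ × ℝ) in 𝓝[>] 0 ×ˢ 𝓝 p, w q.1 q.2.1 (max q.2.2 0) < ψ q.2 := by
      filter_upwards [h1, h2.prod_inr _] with q hq1 hq2 using hq1.trans hq2
    rw [← nhdsWithin_univ p, ← nhdsWithin_prod_eq, eventually_nhdsWithin_iff] at h3
    filter_upwards [h3] with q hq hpos using hq ⟨hpos, mem_univ _⟩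

/-! ### Stability of subsolutions under the relaxed limit. -/

theorem hasDerivAt_sub_sq (c : ℝ) : HasDerivAt (fun y => (y - c) ^ 2) 0 c :=
  (((hasDerivAt_id c).sub_const c).pow 2).congr_deriv (by simp)

/-- Stability: the upper relaxed limit of solutions of the delayed equations is a viscosity
subsolution of the limit equation. -/
theorem isViscositySubsolution_relaxedLimsup {F τ₀ g : ℝ → ℝ} {CF : ℝ≥0} {ξ τ M : ℝ}
    {u₀ : ℝ → ℝ → ℝ} {w : ℝ → ℝ → ℝ → ℝ} (hFmono : Monotone F) (hF : LipschitzWith CF F)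
    (hFM : ∀ p, F p ≤ M) (hξ : 0 < ξ) (hτ₀ : ∀ x, τ₀ x ∈ Icc ξ τ)
    (hτ : Real.exp 1 * CF * τ ≤ 1) (hg : Continuous g)
    (hw : ∀ ε ∈ Ioc (0 : ℝ) 1, ∀ x, ∀ t, 0 ≤ t → |w ε x t - g x| ≤ M * t)
    (hsol : ∀ ε ∈ Ioc (0 : ℝ) 1, IsDelaySolution F τ₀ τ u₀ ⊤ ε (w ε)) :
    IsViscositySubsolution F ⊤ (relaxedLimsup w) := by
  intro φ hφ x t ht hmax
  by_contra! hcon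
  have htpos : 0 < t := ht.1
  set U := relaxedLimsup w with hU
  -- The quadratic makes the maximum strict without changing the gradient at `(x, t)`; the constant
  -- makes `ψ` touch `U` there.
  set ψ : ℝ × ℝ → ℝ := fun p => φ p + ((p.1 - x) ^ 2 + (p.2 - t) ^ 2) + (U x t - φ (x, t)) with hψ
  have hψc : ContDiff ℝ 1 ψ := by fun_prop
  have hψ0 : ψ (x, t) = U x t := by simp [hψ]
  have hd1 : fderiv ℝ ψ (x, t) (1, 0) = fderiv ℝ φ (x, t) (1, 0) := by
    refine (hasDerivAt_fst_line hψc x t).unique ?_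
    have := ((hasDerivAt_fst_line hφ x t).add ((hasDerivAt_sub_sq x).add_const ((t - t) ^ 2))).add_const (U x t - φ (x, t))
    rwa [add_zero] at this
  have hd2 : fderiv ℝ ψ (x, t) (0, 1) = fderiv ℝ φ (x, t) (0, 1) := by
    refine (hasDerivAt_snd_line hψc x t).unique ?_
    have := ((hasDerivAt_snd_line hφ x t).add ((hasDerivAt_sub_sq t).const_add ((x - x) ^ 2))).add_const (U x t - φ (x, t))
    rwa [add_zero] at this
  rw [← hd1, ← hd2] at hcon
  have hfd : Continuous (fderiv ℝ ψ) := hψc.continuous_fderiv one_ne_zero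
  have hc1 : Continuous fun p => F (fderiv ℝ ψ p (1, 0)) :=
    hF.continuous.comp (hfd.clm_apply continuous_const)
  have hc2 : Continuous fun p => fderiv ℝ ψ p (0, 1) := hfd.clm_apply continuous_const
  -- A single level `m` separates the two sides on a whole square, so they may be evaluated at
  -- different points, as the shift and the delay require.
  obtain ⟨m, hm1, hm2⟩ := exists_between hcon
  have hev : ∀ᶠ p in 𝓝 (x, t), F (fderiv ℝ ψ p (1, 0)) < m ∧ m < fderiv ℝ ψ p (0, 1) ∧
      U p.1 p.2 ≤ ψ p - ((p.1 - x) ^ 2 + (p.2 - t) ^ 2) := by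
    filter_upwards [hc1.continuousAt.eventually_lt_const hm1,
      hc2.continuousAt.eventually_const_lt hm2, hmax] with p h1 h2 h3
    exact ⟨h1, h2, by simp only [hψ]; linarith⟩
  obtain ⟨r₀, hr₀, hball⟩ := Metric.nhds_basis_closedBall.eventually_iff.1 hev
  set r := min r₀ (t / 2) with hr
  have hrpos : 0 < r := lt_min hr₀ (by linarith)
  have hrt : r < t := (min_le_right _ _).trans_lt (by linarith)
  set Q : Set (ℝ × ℝ) := Icc (x - r) (x + r) ×ˢ Icc (t - r) (t + r) with hQ
  have hQc : IsCompact Q := isCompact_Icc.prod isCompact_Icc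
  have hQr : ∀ p ∈ Q, F (fderiv ℝ ψ p (1, 0)) < m ∧ m < fderiv ℝ ψ p (0, 1) ∧
      U p.1 p.2 ≤ ψ p - ((p.1 - x) ^ 2 + (p.2 - t) ^ 2) := by
    intro p hp
    refine hball ?_
    rw [← Prod.mk.eta (p := p), ← closedBall_prod_same, Real.closedBall_eq_Icc,
      Real.closedBall_eq_Icc]
    have hrr : r ≤ r₀ := min_le_left _ _
    exact ⟨⟨by linarith [hp.1.1], by linarith [hp.1.2]⟩, by linarith [hp.2.1], by linarith [hp.2.2]⟩
  -- On the layer the quadratic is at least `r ^ 2 / 4`, which leaves strict room for the gap `2 * c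
  -- = r ^ 2 / 8`.
  set c := r ^ 2 / 16 with hcdef
  have hcpos : 0 < c := by positivity
  set A : Set (ℝ × ℝ) := Q ∩ {p | r / 2 ≤ |p.1 - x| ∨ r / 2 ≤ |p.2 - t|} with hA
  have hAc : IsCompact A := by
    refine hQc.inter_right (IsClosed.union ?_ ?_)
    · exact isClosed_le (g := fun p : ℝ × ℝ => |p.1 - x|) continuous_const (by fun_prop)
    · exact isClosed_le (g := fun p : ℝ × ℝ => |p.2 - t|) continuous_const (by fun_prop)
  have hlayer : ∀ p ∈ A, U p.1 p.2 < ψ p - 2 * c := by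
    rintro p ⟨hpQ, hp⟩
    have h1 := (hQr p hpQ).2.2
    have h2 : r ^ 2 / 4 ≤ (p.1 - x) ^ 2 + (p.2 - t) ^ 2 := by
      rcases hp with hp | hp
      · have := pow_le_pow_left₀ (by positivity) hp 2
        rw [sq_abs] at this
        nlinarith [sq_nonneg (p.2 - t)]
      · have := pow_le_pow_left₀ (by positivity) hp 2
        rw [sq_abs] at this
        nlinarith [sq_nonneg (p.1 - x)]
    linarith
  have hsmall := eventually_forall_lt_of_relaxedLimsup_lt hg hw hAc
    (ψ := fun p => ψ p - 2 * c) (hψc.continuous.sub continuous_const) hlayer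
  obtain ⟨N, hN⟩ : ∃ N, ∀ p ∈ Q, -N ≤ fderiv ℝ ψ p (0, 1) :=
    ⟨-m, fun p hp => by linarith [(hQr p hp).2.1]⟩
  have hlim : ∀ k : ℝ, Tendsto (fun ε : ℝ => k * (ε * τ)) (𝓝[>] 0) (𝓝 0) := fun k => by
    have : Continuous fun ε : ℝ => k * (ε * τ) := by fun_prop
    simpa using (this.tendsto 0).mono_left nhdsWithin_le_nhds
  have hcomp : ∀ᶠ ε in 𝓝[>] (0 : ℝ), ∀ y ∈ Icc (x - r / 2) (x + r / 2),
      ∀ s ∈ Icc (t - r) (t + r / 2), w ε y s + c ≤ ψ (y, s) := by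
    filter_upwards [hsmall, Ioc_mem_nhdsGT one_pos, Ioc_mem_nhdsGT (by positivity : 0 < r / 2),
      (hlim 1).eventually_le_const (by positivity : 0 < r / 2),
      (hlim (N + M)).eventually_le_const hcpos] with ε h1 h2 h3 h4 h5 y hy s hs
    rw [one_mul] at h4
    refine (hsol ε h2).add_le_of_supersolution hFmono hF hFM hξ hτ₀ hτ h2.1 hψc hrt
      (fun p hp q hq => ((hQr q hq).1.trans (hQr p hp).2.1).le) hN (fun p hp hpl => ?_) h3.2 h4 h5
      hcpos.le y s hy hs
    have := h1 p ⟨hp, hpl⟩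
    rw [max_eq_left (by linarith [hp.2.1])] at this
    linarith
  -- The solutions lie below `ψ - c` near `(x, t)`, so their upper limit cannot equal `ψ (x, t)`.
  have hfin : U x t ≤ U x t - c / 2 := by
    refine relaxedLimsup_le_of_eventually hg hw ?_
    have hψlt : ∀ᶠ p in 𝓝 (x, t), ψ p < U x t + c / 2 :=
      hψc.continuous.continuousAt.eventually_lt_const (by linarith)
    have hnb : ∀ᶠ p in 𝓝 (x, t), p ∈ Icc (x - r / 2) (x + r / 2) ×ˢ Icc (t - r) (t + r / 2) :=
      prod_mem_nhds (Icc_mem_nhds (by linarith) (by linarith))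
        (Icc_mem_nhds (by linarith) (by linarith))
    filter_upwards [hcomp.prod_inl _, hψlt.prod_inr _, hnb.prod_inr _]
      with q h1 h2 h3
    have := h1 _ h3.1 _ h3.2
    rw [max_eq_left (by linarith [h3.2.1])]
    linarith
  linarith

/-! ### Sign symmetry, uniqueness and identification of the limit. -/

theorem isViscositySupersolution_iff_neg {F : ℝ → ℝ} {T : EReal} {v : ℝ → ℝ → ℝ} :
    IsViscositySupersolution F T v ↔
      IsViscositySubsolution (fun p => -F (-p)) T (fun x t => -v x t) := by
  constructor
  · intro h φ hφ x t ht hmax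
    have := h (fun p => -φ p) hφ.neg x t ht (by
      filter_upwards [hmax] with p hp
      linarith)
    rw [fderiv_fun_neg] at this
    simp only [neg_apply] at this
    linarith
  · intro h φ hφ x t ht hmin
    have := h (fun p => -φ p) hφ.neg x t ht (by
      filter_upwards [hmin] with p hp
      linarith)
    rw [fderiv_fun_neg] at this
    simp only [neg_apply, neg_neg] at this
    linarith

theorem LipschitzWith.neg_comp_neg {F : ℝ → ℝ} {CF : ℝ≥0} (hF : LipschitzWith CF F) :
    LipschitzWith CF fun p => -F (-p) :=
  LipschitzWith.of_dist_le_mul fun p q => by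
    rw [dist_neg_neg, ← dist_neg_neg p q]
    exact hF.dist_le_mul _ _

theorem Monotone.neg_comp_neg {F : ℝ → ℝ} (hF : Monotone F) : Monotone fun p => -F (-p) :=
  fun _ _ h => neg_le_neg (hF (neg_le_neg h))

section Viscosity

variable {F g : ℝ → ℝ} {CF : ℝ≥0} {M L : ℝ} {T : EReal} {u v : ℝ → ℝ → ℝ}

theorem IsViscositySolution.mono (h : IsViscositySolution F g T u) {S : EReal} (hS : S ≤ T) :
    IsViscositySolution F g S u where
  continuousOn := h.continuousOn.mono fun _ hp => ⟨hp.1, hp.2.1, hp.2.2.trans_le hS⟩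
  initial := h.initial
  subsolution φ hφ x t ht := h.subsolution φ hφ x t ⟨ht.1, ht.2.trans_le hS⟩
  supersolution φ hφ x t ht := h.supersolution φ hφ x t ⟨ht.1, ht.2.trans_le hS⟩

theorem lipschitz_neg (hg : ∀ x y, g x ≤ g y + L * |x - y|) (x y : ℝ) :
    -g x ≤ -g y + L * |x - y| := by
  have := hg y x
  rw [abs_sub_comm] at this
  linarith

theorem IsViscositySolution.le (hF : LipschitzWith CF F) (hFM : ∀ p, |F p| ≤ M)
    (hg : ∀ x y, g x ≤ g y + L * |x - y|) (hu : IsViscositySolution F g T u)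
    (hv : IsViscositySolution F g T v) (x t : ℝ) (ht : t ∈ timeIco 0 T) : u x t ≤ v x t := by
  have hM : 0 ≤ M := (abs_nonneg _).trans (hFM 0)
  have hv' := isViscositySupersolution_iff_neg.1 hv.supersolution
  have huc := hu.continuousOn.upperSemicontinuousOn
  have hvc : UpperSemicontinuousOn (fun p : ℝ × ℝ => -v p.1 p.2) (univ ×ˢ timeIco 0 T) :=
    hv.continuousOn.neg.upperSemicontinuousOn
  have := hu.subsolution.add_nonpos (g := g) (M := M) (L := L) hF hM hg hv' huc hvc
    (fun x t ht => hu.subsolution.le_add_mul (fun p => (le_abs_self _).trans (hFM p)) hM hg huc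
      (fun x => (hu.initial x).le) x t ht)
    (fun x t ht => hv'.le_add_mul (g := fun x => -g x) (L := L)
      (fun p => (neg_le_abs _).trans (hFM _)) hM (lipschitz_neg hg) hvc
      (fun x => by rw [hv.initial x]) x t ht) x t ht
  linarith

theorem IsViscositySolution.eqOn (hF : LipschitzWith CF F) (hFM : ∀ p, |F p| ≤ M)
    (hg : ∀ x y, g x ≤ g y + L * |x - y|) (hu : IsViscositySolution F g T u)
    (hv : IsViscositySolution F g T v) (x t : ℝ) (ht : t ∈ timeIco 0 T) : v x t = u x t :=
  le_antisymm (hv.le hF hFM hg hu x t ht) (hu.le hF hFM hg hv x t ht)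

theorem continuous_of_le_add_mul (hg : ∀ x y, g x ≤ g y + L * |x - y|) : Continuous g := by
  refine (LipschitzWith.of_dist_le_mul (K := L.toNNReal) fun x y => ?_).continuous
  rw [Real.dist_eq, Real.dist_eq, abs_le]
  have h1 := hg x y
  have h2 := hg y x
  rw [abs_sub_comm y x] at h2
  have h3 : L * |x - y| ≤ L.toNNReal * |x - y| :=
    mul_le_mul_of_nonneg_right (Real.le_coe_toNNReal L) (abs_nonneg _)
  constructor <;> linarith

/-- The upper relaxed limit of the solutions of the delayed equations is the viscosity solution of
the limit equation, and the lower relaxed limit coincides with it. -/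
theorem relaxedLimsup_spec {τ₀ : ℝ → ℝ} {ξ τ : ℝ} {u₀ : ℝ → ℝ → ℝ} {w : ℝ → ℝ → ℝ → ℝ}
    (hFmono : Monotone F) (hF : LipschitzWith CF F) (hFM : ∀ p, |F p| ≤ M) (hξ : 0 < ξ)
    (hτ₀ : ∀ x, τ₀ x ∈ Icc ξ τ) (hτ : Real.exp 1 * CF * τ ≤ 1)
    (hg : ∀ x y, g x ≤ g y + L * |x - y|)
    (hw : ∀ ε ∈ Ioc (0 : ℝ) 1, ∀ x, ∀ t, 0 ≤ t → |w ε x t - g x| ≤ M * t)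
    (hsol : ∀ ε ∈ Ioc (0 : ℝ) 1, IsDelaySolution F τ₀ τ u₀ ⊤ ε (w ε)) :
    IsViscositySolution F g ⊤ (relaxedLimsup w) ∧
      ∀ x t, 0 ≤ t → relaxedLimsup (fun ε x t => -w ε x t) x t = -relaxedLimsup w x t := by
  have hM : 0 ≤ M := (abs_nonneg _).trans (hFM 0)
  have hgc := continuous_of_le_add_mul hg
  set U := relaxedLimsup w with hU
  set V := relaxedLimsup (fun ε x t => -w ε x t) with hV
  have hUc := upperSemicontinuous_relaxedLimsup hgc hw
  have hVc := upperSemicontinuous_relaxedLimsup hgc.neg (neg_bound hw)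
  have hUb := relaxedLimsup_le_add hgc hw
  have hVb := relaxedLimsup_le_add hgc.neg (neg_bound hw)
  have hUV := relaxedLimsup_add_neg_nonneg hgc hw
  have hUs : IsViscositySubsolution F ⊤ U := isViscositySubsolution_relaxedLimsup hFmono hF
    (fun p => (le_abs_self _).trans (hFM p)) hξ hτ₀ hτ hgc hw hsol
  have hVs : IsViscositySubsolution (fun p => -F (-p)) ⊤ V :=
    isViscositySubsolution_relaxedLimsup hFmono.neg_comp_neg hF.neg_comp_neg
      (fun p => (neg_le_abs _).trans (hFM _)) hξ hτ₀ hτ hgc.neg (neg_bound hw)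
      fun ε hε => (hsol ε hε).neg
  have hVU : ∀ x t, 0 ≤ t → V x t = -U x t := by
    intro x t ht
    have h1 := hUs.add_nonpos (g := g) (M := M) (L := L) hF hM hg hVs
      (hUc.upperSemicontinuousOn _) (hVc.upperSemicontinuousOn _) (fun x t ht => hUb x t ht.1)
      (fun x t ht => hVb x t ht.1) x t ⟨ht, EReal.coe_lt_top t⟩
    linarith [hUV x t]
  refine ⟨⟨?_, fun x => ?_, hUs, isViscositySupersolution_iff_neg.2 ?_⟩, hVU⟩
  -- `U` is upper semicontinuous as an upper limit, and lower semicontinuous because `-U = V` is one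
  -- too.
  · refine continuousOn_iff_lower_upperSemicontinuousOn.2
      ⟨fun p hp a ha => ?_, hUc.upperSemicontinuousOn _⟩
    have hVp : V p.1 p.2 < -a := by
      rw [hVU _ _ hp.2.1]
      exact neg_lt_neg ha
    filter_upwards [mem_nhdsWithin_of_mem_nhds (hVc p _ hVp), self_mem_nhdsWithin] with q hq hq'
    have : V q.1 q.2 < -a := hq
    rw [hVU _ _ hq'.2.1] at this
    exact neg_lt_neg_iff.1 this
  · have h1 := hUb x 0 le_rfl
    have h2 := hVb x 0 le_rfl
    have h3 := hVU x 0 le_rfl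
    have h4 : V x 0 ≤ -g x + M * 0 := h2
    linarith
  · intro φ hφ x t ht hmax
    refine hVs φ hφ x t ht ?_
    -- `V = -U` is known only for nonnegative times; near an interior point this suffices.
    have hev : ∀ᶠ p : ℝ × ℝ in 𝓝 (x, t), 0 < p.2 :=
      continuousAt_snd.eventually_const_lt ht.1
    filter_upwards [hmax, hev] with p hp hp0
    rw [hVU _ _ hp0.le, hVU _ _ ht.1.le]
    exact hp

end Viscosity

/-! ### The homogenization theorem. -/

theorem theorem1p1 (F : ℝ → ℝ) (CF : ℝ≥0) (τ₀ : ℝ → ℝ) (ξ τ : ℝ) (u₀ : ℝ → ℝ → ℝ) (L : ℝ≥0)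
    (T : EReal) (hT : 0 < T)
    (hFmono : Monotone F) (hFbdd : ∃ M : ℝ, ∀ p : ℝ, |F p| ≤ M) (hFlip : LipschitzWith CF F)
    (hξ : 0 < ξ) (hτ₀ : closure (range τ₀) = Icc ξ τ)
    (hu₀ : LipschitzOnWith L (fun p : ℝ × ℝ => u₀ p.1 p.2) (univ ×ˢ Icc (-(2 * τ)) 0))
    -- `τ < 1 / (e C_F)`, where `1 / (e C_F) = +∞` if `C_F = 0`
    (hτ : Real.exp 1 * CF * τ < 1) :
    -- the rescaled delayed problem is well posed
    (∀ ε ∈ Ioc (0 : ℝ) 1, ∃ u : ℝ → ℝ → ℝ, IsDelaySolution F τ₀ τ u₀ T ε u ∧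
      ∀ v : ℝ → ℝ → ℝ, IsDelaySolution F τ₀ τ u₀ T ε v →
        ∀ x : ℝ, ∀ t ∈ timeIco (-(2 * ε * τ)) T, v x t = u x t) ∧
    -- the limit problem has a unique viscosity solution, and the delayed solutions converge to it
    (∃ u : ℝ → ℝ → ℝ, IsViscositySolution F (fun x => u₀ x 0) T u ∧
      (∀ v : ℝ → ℝ → ℝ, IsViscositySolution F (fun x => u₀ x 0) T v →
        ∀ x : ℝ, ∀ t ∈ timeIco 0 T, v x t = u x t) ∧
      ∀ uε : ℝ → ℝ → ℝ → ℝ,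
        (∀ ε ∈ Ioc (0 : ℝ) 1, IsDelaySolution F τ₀ τ u₀ T ε (uε ε)) →
          TendstoLocallyUniformlyOn (fun (ε : ℝ) (p : ℝ × ℝ) => uε ε p.1 p.2)
            (fun p : ℝ × ℝ => u p.1 p.2) (𝓝[>] 0) (univ ×ˢ timeIco 0 T)) := by
  obtain ⟨M, hM⟩ := hFbdd
  have hτ₀' : ∀ x, τ₀ x ∈ Icc ξ τ := fun x => hτ₀ ▸ subset_closure (mem_range_self x)
  have hτpos : 0 < τ := hξ.trans_le ((hτ₀' 0).1.trans (hτ₀' 0).2)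
  have hu₀c : ∀ ε ∈ Ioc (0 : ℝ) 1, ∀ x, ContinuousOn (u₀ x) (Icc (-(2 * ε * τ)) 0) := by
    intro ε hε x
    refine hu₀.continuousOn.comp (f := fun t => (x, t)) (by fun_prop) fun t ht =>
      ⟨mem_univ _, ?_, ht.2⟩
    have : ε * τ ≤ 1 * τ := mul_le_mul_of_nonneg_right hε.2 hτpos.le
    linarith [ht.1]
  have hg : ∀ x y, u₀ x 0 ≤ u₀ y 0 + L * |x - y| := by
    intro x y
    have h0 : (0 : ℝ) ∈ Icc (-(2 * τ)) 0 := ⟨by linarith, le_rfl⟩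
    have h := hu₀.dist_le_mul (x, 0) ⟨mem_univ _, h0⟩ (y, 0) ⟨mem_univ _, h0⟩
    rw [Prod.dist_eq, dist_self, max_eq_left dist_nonneg, Real.dist_eq, Real.dist_eq] at h
    linarith [le_abs_self (u₀ x 0 - u₀ y 0)]
  -- The problem is solved with infinite horizon and the limit restricted afterwards; uniqueness
  -- identifies any solution up to `T` with `w`.
  set w : ℝ → ℝ → ℝ → ℝ := fun ε => delayFlow F τ₀ ξ τ u₀ ε with hw
  have hsol : ∀ ε ∈ Ioc (0 : ℝ) 1, IsDelaySolution F τ₀ τ u₀ ⊤ ε (w ε) := fun ε hε =>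
    isDelaySolution_delayFlow hFlip.continuous hε.1 hξ hτpos (fun x => (hτ₀' x).1) (hu₀c ε hε) ⊤
  have hbound : ∀ ε ∈ Ioc (0 : ℝ) 1, ∀ x, ∀ t, 0 ≤ t → |w ε x t - u₀ x 0| ≤ M * t :=
    fun ε hε x t ht => (hsol ε hε).abs_sub_le hM (mul_pos hε.1 hτpos).le x t
      ⟨ht, EReal.coe_lt_top t⟩
  obtain ⟨hvisc, hneg⟩ := relaxedLimsup_spec hFmono hFlip hM hξ hτ₀' hτ.le hg hbound hsol
  have hgc : Continuous fun x => u₀ x 0 := continuous_of_le_add_mul hg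
  have huniq : ∀ ε ∈ Ioc (0 : ℝ) 1, ∀ v, IsDelaySolution F τ₀ τ u₀ T ε v →
      ∀ x, ∀ t ∈ timeIco (-(2 * ε * τ)) T, v x t = w ε x t := fun ε hε v hv x t ht =>
    ((hsol ε hε).mono le_top).eqOn hε.1 hξ hτ₀' hv x t ht
  refine ⟨fun ε hε => ⟨w ε, (hsol ε hε).mono le_top, huniq ε hε⟩, relaxedLimsup w,
    hvisc.mono le_top, fun v hv => (hvisc.mono le_top).eqOn hFlip hM hg hv, fun uε huε => ?_⟩
  rw [Metric.tendstoLocallyUniformlyOn_iff]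
  rintro η hη ⟨x, t⟩ hxt
  have hUp := eventually_lt_of_relaxedLimsup_lt hgc hbound (x := x) (t := t)
    (a := relaxedLimsup w x t + η / 2) (by linarith)
  have hLow := eventually_lt_of_relaxedLimsup_lt hgc.neg (neg_bound hbound) (x := x) (t := t)
    (a := -relaxedLimsup w x t + η / 2) (by rw [hneg x t hxt.2.1]; linarith)
  have hcont := Metric.continuousOn_iff'.1 (hvisc.mono (le_top : T ≤ ⊤)).continuousOn (x, t) hxt
    (η / 2) (by positivity)
  -- On this product neighbourhood both one-sided limits confine `w` to within `η / 2` of the limit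
  -- at `(x, t)`; continuity of the limit supplies the other `η / 2`.
  obtain ⟨A, hA, B, hB, hAB⟩ := mem_prod_iff.1 (hUp.and hLow)
  refine ⟨_, inter_mem (mem_nhdsWithin_of_mem_nhds hB) (inter_mem hcont self_mem_nhdsWithin), ?_⟩
  filter_upwards [hA, Ioc_mem_nhdsGT one_pos] with ε hεA hε q hq
  obtain ⟨hqB, hqc, hqs⟩ := hq
  have h := hAB (mk_mem_prod hεA hqB)
  have hετ : 0 < ε * τ := mul_pos hε.1 hτpos
  simp only [mem_ofPred_eq, max_eq_left hqs.2.1] at h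
  have hqc' : dist (relaxedLimsup w q.1 q.2) (relaxedLimsup w x t) < η / 2 := hqc
  rw [Real.dist_eq, abs_lt] at hqc'
  rw [huniq ε hε _ (huε ε hε) q.1 q.2 ⟨by linarith [hqs.2.1], hqs.2.2⟩, Real.dist_eq, abs_lt]
  constructor <;> linarith [h.1, h.2]
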